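/- Let $R$ be an associative ring with identity; "module" means left $R$-module, and complexes are cochain complexes $X=(\cdots\to X^{i}\xrightarrow{d_X^{i}}X^{i+1}\to\cdots)$ of modules indexed by $\mathbb Z$. A module is also regarded as a complex concentrated in degree $0$. A short exact sequence $0\to A\xrightarrow{f} B\xrightarrow{g} C\to 0$ is *pure exact* if $0\to M\otimes_R A\to M\otimes_R B\to M\otimes_R C\to 0$ is exact for every right $R$-module $M$; then $f$ is called *pure monic* and $g$ *pure epic*. A module is *pure projective* if it is projective with respect to pure exact sequences. A complex $X$ is *pure exact at $n$* if each of $d_X^{n-1}$, $d_X^{n}$ is the composite of a pure epic map followed by a pure monic map, and $0\to\operatorname{Ker}d_X^{n}\to X^{n}\to\operatorname{Coker}d_X^{n-1}\to 0$ (with the canonical maps) is pure exact; it is *pure exact* if it is pure exact at every $n$. Let $\inf_p X$ and $\sup_p X$ be the infimum and the supremum in $[-\infty,\infty]$ of $\{n\in\mathbb Z\mid X\text{ is not pure exact at }n\}$ (so $\inf_pX=\infty$ and $\sup_pX=-\infty$ if $X$ is pure exact). A cochain map is a *pure quasi-isomorphism* if its mapping cone is pure exact. The *pure derived category* $\mathbf{D}_{pur}(R)$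 is the Verdier quotient of the homotopy category $\mathbf K(R)$ of complexes by the pure exact complexes, and $\mathbf{D}^b_{pur}(R)$ consists of the complexes that are isomorphic in $\mathbf{D}_{pur}(R)$ to a bounded complex. A *pure projective resolution* of $X$ is a pure quasi-isomorphism $P\to X$ with all $P^i$ pure projective and such that the total Hom complex $\operatorname{Hom}_R(P,E)$ is a pure exact complex of abelian groups for every pure exact complex $E$ of modules. Write $\operatorname{ppd}_R X\le n$ if $X$ has a pure projective resolution $P\to X$ with $P^{i}=0$ for all $i<-n$. For $X\in\mathbf{D}^b_{pur}(R)$ (such $X$ has a pure projective resolution $P\to X$, and the following does not depend on its choice, up to isomorphism) and any complex $Y$, put $\operatorname{Pext}^i_R(X,Y)=H^i\operatorname{Hom}_R(P,Y)$. A complex is *contractible* if its identity map is homotopic to zero. **Theorem.** For any $X\in\mathbf{D}^b_{pur}(R)$ and $n\in\mathbb Z$, the following statements are equivalent. 1. $\operatorname{ppd}_R X\le n$. 2. $\inf_p X\ge -n$, and for every pure projective resolution $P'\to X$ the module $\operatorname{Coker}d_{P'}^{-n-1}$ is pure projective. 3. For every pure projective resolution $P'\to X$ there is an isomorphism of complexes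 $P'\cong P_1\oplus P_2$ with $P_1^{i}=0$ for all $i<-n$ and $P_2$ contractible. 4. $\operatorname{Pext}^i_R(X,Y)=0$ for every $Y\in\mathbf{D}_{pur}(R)$ and every integer $i>n+\sup_p Y$. 5. $\inf_p X\ge -n$, and $\operatorname{Pext}^{n+1}_R(X,N)=0$ for every module $N$. -/

import Mathlib

open CategoryTheory CategoryTheory.Limits
open scoped TensorProduct

universe w v u

noncomputable section

namespace PureDerived

/-! ## Tensor products of a right and a left module over an arbitrary ring -/

section Tensor

variable (R : Type w) [Ring R]

/-- The subgroup of `M ⊗[ℤ] A` generated by all `(m r) ⊗ a - m ⊗ (r a)`, for a right `R`-module `M`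
(a module over the opposite ring) and a left `R`-module `A`. -/
def balancedRel (M : Type*) [AddCommGroup M] [Module Rᵐᵒᵖ M]
    (A : Type*) [AddCommGroup A] [Module R A] : AddSubgroup (M ⊗[ℤ] A) :=
  AddSubgroup.closure
    {t | ∃ (m : M) (r : R) (a : A), t = (MulOpposite.op r • m) ⊗ₜ[ℤ] a - m ⊗ₜ[ℤ] (r • a)}

/-- The abelian group `M ⊗_R A`, for a right `R`-module `M` and a left `R`-module `A`. -/
abbrev RTensor (M : Type*) [AddCommGroup M] [Module Rᵐᵒᵖ M]
    (A : Type*) [AddCommGroup A] [Module R A] : Type _ :=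
  (M ⊗[ℤ] A) ⧸ balancedRel R M A

variable {R}

lemma balancedRel_le_comap (M : Type*) [AddCommGroup M] [Module Rᵐᵒᵖ M]
    {A B : Type*} [AddCommGroup A] [Module R A] [AddCommGroup B] [Module R B] (f : A →ₗ[R] B) :
    balancedRel R M A ≤
      (balancedRel R M B).comap
        (LinearMap.lTensor M f.toAddMonoidHom.toIntLinearMap).toAddMonoidHom := by
  refine (AddSubgroup.closure_le _).2 ?_
  rintro _ ⟨m, r, a, rfl⟩
  refine AddSubgroup.subset_closure ⟨m, r, f a, ?_⟩
  simp

/-- The homomorphism `M ⊗_R f : M ⊗_R A → M ⊗_R B` induced by an `R`-linear map `f : A → B`;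
it sends the class of `m ⊗ a` to the class of `m ⊗ f a`. -/
def RTensor.map (M : Type*) [AddCommGroup M] [Module Rᵐᵒᵖ M]
    {A B : Type*} [AddCommGroup A] [Module R A] [AddCommGroup B] [Module R B] (f : A →ₗ[R] B) :
    RTensor R M A →+ RTensor R M B :=
  QuotientAddGroup.map (balancedRel R M A) (balancedRel R M B)
    (LinearMap.lTensor M f.toAddMonoidHom.toIntLinearMap).toAddMonoidHom (balancedRel_le_comap M f)

end Tensor

/-! ## Purity -/

variable {R : Type w} [Ring R]

/-- A short exact sequence `0 → A → B → C → 0` of left `R`-modules is pure exact if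
`0 → M ⊗_R A → M ⊗_R B → M ⊗_R C → 0` is exact for every right `R`-module `M`. -/
def IsPureShortExact (S : ShortComplex (ModuleCat.{v} R)) : Prop :=
  S.ShortExact ∧
    ∀ (M : Type (max w v)) [AddCommGroup M] [Module Rᵐᵒᵖ M],
      Function.Injective (RTensor.map M S.f.hom) ∧
      Function.Exact (RTensor.map M S.f.hom) (RTensor.map M S.g.hom) ∧
      Function.Surjective (RTensor.map M S.g.hom)

/-- `f` is pure monic: it is the first map of a pure exact sequence `0 → A → B → C → 0`. -/
def IsPureMono {A B : ModuleCat.{v} R} (f : A ⟶ B) : Prop :=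
  ∃ (C : ModuleCat.{v} R) (g : B ⟶ C) (h : f ≫ g = 0), IsPureShortExact (ShortComplex.mk f g h)

/-- `g` is pure epic: it is the second map of a pure exact sequence `0 → A → B → C → 0`. -/
def IsPureEpi {B C : ModuleCat.{v} R} (g : B ⟶ C) : Prop :=
  ∃ (A : ModuleCat.{v} R) (f : A ⟶ B) (h : f ≫ g = 0), IsPureShortExact (ShortComplex.mk f g h)

/-- `d` decomposes as a pure epic map followed by a pure monic one. -/
def HasPureDecomposition {A B : ModuleCat.{v} R} (d : A ⟶ B) : Prop :=
  ∃ (D : ModuleCat.{v} R) (p : A ⟶ D) (j : D ⟶ B), IsPureEpi p ∧ IsPureMono j ∧ p ≫ j = d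

/-- A complex `X` is pure exact at `n` if both `d^{n-1}` and `d^n` decompose as a pure epic map
followed by a pure monic one, and `0 → Ker d^n → X^n → Coker d^{n-1} → 0` is pure exact. -/
def IsPureExactAt (X : CochainComplex (ModuleCat.{v} R) ℤ) (n : ℤ) : Prop :=
  HasPureDecomposition (X.d (n - 1) n) ∧ HasPureDecomposition (X.d n (n + 1)) ∧
    ∃ h : kernel.ι (X.d n (n + 1)) ≫ cokernel.π (X.d (n - 1) n) = 0,
      IsPureShortExact
        (ShortComplex.mk (kernel.ι (X.d n (n + 1))) (cokernel.π (X.d (n - 1) n)) h)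

/-- A complex is pure exact if it is pure exact at every `n`. -/
def IsPureExact (X : CochainComplex (ModuleCat.{v} R) ℤ) : Prop :=
  ∀ n : ℤ, IsPureExactAt X n

/-- A module is pure projective if it is projective with respect to pure exact sequences. -/
def IsPureProjective (M : ModuleCat.{v} R) : Prop :=
  ∀ S : ShortComplex (ModuleCat.{v} R), IsPureShortExact S →
    ∀ g : M ⟶ S.X₃, ∃ h : M ⟶ S.X₂, h ≫ S.g = g

/-- A cochain map is a pure quasi-isomorphism if its mapping cone is pure exact. -/
def IsPureQuasiIso {X Y : CochainComplex (ModuleCat.{v} R) ℤ} (f : X ⟶ Y) : Prop :=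
  IsPureExact (CochainComplex.mappingCone f)

/-- `inf_p X`, the infimum in `[-∞, ∞]` of the degrees at which `X` is not pure exact. -/
def infP (X : CochainComplex (ModuleCat.{v} R) ℤ) : EReal :=
  sInf {x : EReal | ∃ n : ℤ, ¬ IsPureExactAt X n ∧ x = ((n : ℝ) : EReal)}

/-- `sup_p X`, the supremum in `[-∞, ∞]` of the degrees at which `X` is not pure exact. -/
def supP (X : CochainComplex (ModuleCat.{v} R) ℤ) : EReal :=
  sSup {x : EReal | ∃ n : ℤ, ¬ IsPureExactAt X n ∧ x = ((n : ℝ) : EReal)}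

/-! ## The pure derived category -/

variable (R) in
/-- The pure exact complexes, as a class of objects of the homotopy category `K(R)`. -/
def pureExactComplexes :
    ObjectProperty (HomotopyCategory (ModuleCat.{v} R) (ComplexShape.up ℤ)) :=
  fun X => IsPureExact X.as

variable (R) in
/-- The pure derived category `D_pur(R)`, the Verdier quotient of `K(R)` by the pure exact
complexes: the localization of `K(R)` at all morphisms with a pure exact cone. -/
abbrev DPur : Type _ := (pureExactComplexes.{w, v} R).trW.Localization

variable (R) in
/-- The canonical functor from complexes to the pure derived category. -/
def toDPur : CochainComplex (ModuleCat.{v} R) ℤ ⥤ DPur.{w, v} R :=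
  HomotopyCategory.quotient (ModuleCat.{v} R) (ComplexShape.up ℤ) ⋙
    (pureExactComplexes.{w, v} R).trW.Q

/-- `X^i = 0` for `i ≪ 0` and for `i ≫ 0`. -/
def IsBounded (X : CochainComplex (ModuleCat.{v} R) ℤ) : Prop :=
  ∃ a b : ℤ, ∀ i : ℤ, (i < a ∨ b < i) → IsZero (X.X i)

/-- `X` belongs to `D^b_pur(R)`, as a full subcategory of `D_pur(R)` closed under isomorphisms:
`X` is isomorphic in `D_pur(R)` to a bounded complex (for instance, `X` is bounded). -/
def InDbPur (X : CochainComplex (ModuleCat.{v} R) ℤ) : Prop :=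
  ∃ B : CochainComplex (ModuleCat.{v} R) ℤ, IsBounded B ∧
    Nonempty ((toDPur R).obj X ≅ (toDPur R).obj B)

/-! ## Resolutions, dimension and derived functors -/

/-- The total complex `Hom_R(X, Y)` of abelian groups: in degree `n` it is
`∏ i, Hom_R(X^i, Y^{i+n})`, with differential `φ ↦ d_Y ∘ φ - (-1)^n φ ∘ d_X`. -/
def homComplex (X Y : CochainComplex (ModuleCat.{v} R) ℤ) : CochainComplex (ModuleCat.{v} ℤ) ℤ where
  X n := ModuleCat.of ℤ (CochainComplex.HomComplex.Cochain X Y n)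
  d i j := ModuleCat.ofHom (CochainComplex.HomComplex.δ_hom ℤ X Y i j)
  shape i j hij := by
    exact ModuleCat.hom_ext (LinearMap.ext fun z => CochainComplex.HomComplex.δ_shape i j hij z)
  d_comp_d' i j k _ _ := by
    exact ModuleCat.hom_ext (LinearMap.ext fun z => CochainComplex.HomComplex.δ_δ i j k z)

/-- A pure projective resolution of `X`: a pure quasi-isomorphism `f : P ⟶ X` from a complex of pure
projective modules such that `Hom_R(P, -)` takes pure exact complexes of `R`-modules to pure exact
complexes of abelian groups. -/
structure PureProjRes (X : CochainComplex (ModuleCat.{v} R) ℤ) where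
  /-- the resolving complex -/
  P : CochainComplex (ModuleCat.{v} R) ℤ
  /-- the resolving map -/
  f : P ⟶ X
  isPureQuasiIso : IsPureQuasiIso f
  isPureProjective : ∀ i : ℤ, IsPureProjective (P.X i)
  preserves : ∀ E : CochainComplex (ModuleCat.{v} R) ℤ, IsPureExact E → IsPureExact (homComplex P E)

/-- `ppd X ≤ n`: some pure projective resolution `P` of `X` has `P^i = 0` for all `i < -n`. -/
def PPDLE (X : CochainComplex (ModuleCat.{v} R) ℤ) (n : ℤ) : Prop :=
  ∃ ρ : PureProjRes X, ∀ i : ℤ, i < -n → IsZero (ρ.P.X i)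

open Classical in
/-- `Pext^i(X, Y) = H^i Hom_R(P, Y)`, where `P` is a pure projective resolution of `X` (the result
does not depend on the choice, up to isomorphism). The value `0` is assigned if `X` has no
pure projective resolution, which does not happen for `X` in `D^b_pur(R)`. -/
def Pext (i : ℤ) (X Y : CochainComplex (ModuleCat.{v} R) ℤ) : ModuleCat.{v} ℤ :=
  if h : Nonempty (PureProjRes X) then (homComplex h.some.P Y).homology i else ModuleCat.of ℤ PUnit

/-- A complex is contractible if its identity map is homotopic to zero. -/
def IsContractible (X : CochainComplex (ModuleCat.{v} R) ℤ) : Prop :=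
  Nonempty (Homotopy (𝟙 X) 0)

/-- A module, regarded as a complex concentrated in degree `0`. -/
def stalk (N : ModuleCat.{v} R) : CochainComplex (ModuleCat.{v} R) ℤ :=
  (HomologicalComplex.single (ModuleCat.{v} R) (ComplexShape.up ℤ) 0).obj N

end PureDerived

end

noncomputable section

namespace PureDerived

/-! ## Purity in terms of finite systems of linear equations -/

section Systems

variable {R : Type w} [Ring R]

/-! Purity is a statement about finite linear systems: an epimorphism is pure when it lifts
solutions of homogeneous systems, a monomorphism when it reflects solvability of inhomogeneous ones.
For a complex this gives two elementwise conditions in each degree, `HomExactAt` and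
`TensorExactAt`. Imposed in all degrees, either one amounts to pure exactness, but they behave
differently on half-lines: the tensor condition below `N` already gives pure exactness below `N`, so
it is the form in which `infP` is used, while vanishing above `supP` is used through the Hom
condition.

A pure projective resolution is orthogonal in K(R) to all pure exact complexes. Conversely, this
orthogonality makes the Hom complex pure exact (`isPureExact_homComplex_of_pureKProjective`). The
pure exact complexes are exactly the right orthogonal of these objects, hence triangulated, and maps
in the pure derived category out of such objects are computed in K(R). This yields existence of
resolutions and independence of the choice.

The conditions are then linked in a cycle. If P vanishes below -n and Y is Hom-exact from degree i-n
on, a cocycle of degree i becomes a boundary in a pure exact quotient of Y that agrees with Y from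
degree i-n on; the bounding cochain lifts by pure projectivity (`mem_coboundaries_of_isZero`).
Testing vanishing of Pext against the module Coker d^{k-1} of P extends its projection along d^k.
This gives tensor exactness in degree k, and for k = -n-1 it makes Coker d^{-n-1} a retract of
P^{-n}. If P is tensor exact below -n and this cokernel is pure projective, the projection onto it
splits, and the resulting idempotent of P cuts off a contractible summand
(`exists_biprod_iso_of_isPureProjective_cokernel`). Finally, deleting a contractible summand does
not change the homotopy type, so the remaining summand is again a resolution. -/

/-- Every solution in `C` of a finite homogeneous linear system lifts along `g` to a solution
in `B`. -/
def LiftsSystems {B C : Type*} [AddCommGroup B] [Module R B] [AddCommGroup C] [Module R C]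
    (g : B →ₗ[R] C) : Prop :=
  ∀ (m n : ℕ) (a : Fin m → Fin n → R) (c : Fin n → C), (∀ i, ∑ j, a i j • c j = 0) →
    ∃ b : Fin n → B, (∀ i, ∑ j, a i j • b j = 0) ∧ ∀ j, g (b j) = c j

/-- Every finite inhomogeneous linear system with constants in `A` which is solvable in `B` is
solvable in `A`. -/
def ReflectsSystems {A B : Type*} [AddCommGroup A] [Module R A] [AddCommGroup B] [Module R B]
    (f : A →ₗ[R] B) : Prop :=
  ∀ (m n : ℕ) (a : Fin m → Fin n → R) (x : Fin m → A) (b : Fin n → B),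
    (∀ i, f (x i) = ∑ j, a i j • b j) → ∃ y : Fin n → A, ∀ i, x i = ∑ j, a i j • y j

variable {A B C : Type*} [AddCommGroup A] [Module R A] [AddCommGroup B] [Module R B]
  [AddCommGroup C] [Module R C] {f : A →ₗ[R] B} {g : B →ₗ[R] C}

lemma LiftsSystems.surjective (hg : LiftsSystems g) : Function.Surjective g := fun c => by
  obtain ⟨b, -, hb⟩ := hg 0 1 (fun _ _ => 0) (fun _ => c) (fun i => i.elim0)
  exact ⟨b 0, hb 0⟩

lemma ReflectsSystems.injective (hf : ReflectsSystems f) : Function.Injective f := by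
  refine (injective_iff_map_eq_zero f).2 fun x hx => ?_
  obtain ⟨y, hy⟩ := hf 1 0 (fun _ _ => 0) (fun _ => x) (fun i => i.elim0) (by simpa using hx)
  simpa using hy 0

/-- An arbitrary lift of the solution satisfies the equations up to an error in `A`; solving for
this error inside `A` gives the correction. -/
lemma ReflectsSystems.liftsSystems (hf : ReflectsSystems f) (h : Function.Exact f g)
    (hg : Function.Surjective g) : LiftsSystems g := by
  intro m n a c hc
  choose b hb using fun j => hg (c j)
  have hx : ∀ i, ∃ x, f x = ∑ j, a i j • b j := fun i => (h _).1 (by simp [hb, hc])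
  choose x hx using hx
  obtain ⟨y, hy⟩ := hf m n a x b hx
  refine ⟨fun j => b j - f (y j), fun i => ?_, fun j => ?_⟩
  · simp only [smul_sub, Finset.sum_sub_distrib]
    rw [← hx, hy]
    simp
  · simp [hb, h.apply_apply_eq_zero]

lemma LiftsSystems.reflectsSystems (hg : LiftsSystems g) (h : Function.Exact f g)
    (hf : Function.Injective f) : ReflectsSystems f := by
  intro m n a x b hx
  obtain ⟨b', hb', hgb⟩ := hg m n a (fun j => g (b j)) fun i => by
    have := congrArg g (hx i)
    simpa [h.apply_apply_eq_zero] using this.symm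
  have hy : ∀ j, ∃ y, f y = b j - b' j := fun j => (h _).1 (by simp [hgb])
  choose y hy using hy
  refine ⟨y, fun i => hf ?_⟩
  simp [hy, smul_sub, Finset.sum_sub_distrib, hb', hx]

end Systems

/-! ### Right exactness of the tensor product -/

section Tensor

variable {R : Type w} [Ring R]

/-- The homomorphism out of `M ⊗_R A` induced by a balanced biadditive map. -/
def RTensor.lift {M A Q : Type*} [AddCommGroup M] [Module Rᵐᵒᵖ M] [AddCommGroup A] [Module R A]
    [AddCommGroup Q] (φ : M →+ A →+ Q)
    (hφ : ∀ m (r : R) a, φ (MulOpposite.op r • m) a = φ m (r • a)) : RTensor R M A →+ Q :=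
  QuotientAddGroup.lift _
    (TensorProduct.liftAddHom φ fun r m a => by simp) <| by
    refine (AddSubgroup.closure_le _).2 ?_
    rintro _ ⟨m, r, a, rfl⟩
    simp [hφ, AddMonoidHom.mem_ker]

variable (R) in
/-- The class of `m ⊗ a`. -/
def RTensor.tmul {M A : Type*} [AddCommGroup M] [Module Rᵐᵒᵖ M] [AddCommGroup A] [Module R A]
    (m : M) (a : A) : RTensor R M A :=
  QuotientAddGroup.mk (m ⊗ₜ[ℤ] a)

section

variable {M A B C : Type*} [AddCommGroup M] [Module Rᵐᵒᵖ M] [AddCommGroup A] [Module R A]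
  [AddCommGroup B] [Module R B] [AddCommGroup C] [Module R C]

lemma RTensor.lift_tmul {Q : Type*} [AddCommGroup Q] (φ : M →+ A →+ Q)
    (hφ : ∀ m (r : R) a, φ (MulOpposite.op r • m) a = φ m (r • a)) (m : M) (a : A) :
    RTensor.lift φ hφ (RTensor.tmul R m a) = φ m a := rfl

lemma RTensor.map_tmul (f : A →ₗ[R] B) (m : M) (a : A) :
    RTensor.map M f (RTensor.tmul R m a) = RTensor.tmul R m (f a) := rfl

lemma RTensor.tmul_add (m : M) (a a' : A) :
    RTensor.tmul R m (a + a') = RTensor.tmul R m a + RTensor.tmul R m a' := by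
  simp [RTensor.tmul, TensorProduct.tmul_add]

lemma RTensor.add_tmul (m m' : M) (a : A) :
    RTensor.tmul R (m + m') a = RTensor.tmul R m a + RTensor.tmul R m' a := by
  simp [RTensor.tmul, TensorProduct.add_tmul]

lemma RTensor.tmul_smul (m : M) (r : R) (a : A) :
    RTensor.tmul R m (r • a) = RTensor.tmul R (MulOpposite.op r • m) a := by
  refine (QuotientAddGroup.eq_iff_sub_mem.2 ?_).symm
  exact AddSubgroup.subset_closure ⟨m, r, a, rfl⟩

/-- `a ↦ m ⊗ a` as a homomorphism. -/
def RTensor.tmulHom (m : M) : A →+ RTensor R M A :=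
  AddMonoidHom.mk' (RTensor.tmul R m) (RTensor.tmul_add m)

lemma RTensor.induction_on {p : RTensor R M A → Prop} (t : RTensor R M A) (h0 : p 0)
    (ht : ∀ m a, p (RTensor.tmul R m a)) (hadd : ∀ s t, p s → p t → p (s + t)) : p t := by
  obtain ⟨t, rfl⟩ := QuotientAddGroup.mk_surjective t
  induction t using TensorProduct.induction_on with
  | zero => exact h0
  | tmul m a => exact ht m a
  | add s t hs ht => exact hadd _ _ hs ht

lemma RTensor.map_surjective {g : B →ₗ[R] C} (hg : Function.Surjective g) :
    Function.Surjective (RTensor.map M g) := fun t => by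
  induction t using RTensor.induction_on with
  | h0 => exact ⟨0, map_zero _⟩
  | ht m c =>
    obtain ⟨b, rfl⟩ := hg c
    exact ⟨RTensor.tmul R m b, rfl⟩
  | hadd s t hs ht =>
    obtain ⟨s, rfl⟩ := hs
    obtain ⟨t, rfl⟩ := ht
    exact ⟨s + t, map_add _ _ _⟩

/-- A left inverse to the map from the cokernel of `M ⊗ f` to `M ⊗ C` is built from a set-theoretic
section of `g`; modulo the range of `M ⊗ f` the choice of preimage does not matter. -/
lemma RTensor.map_exact {f : A →ₗ[R] B} {g : B →ₗ[R] C} (h : Function.Exact f g)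
    (hg : Function.Surjective g) : Function.Exact (RTensor.map M f) (RTensor.map M g) := by
  have hzero : ∀ t, RTensor.map M g (RTensor.map M f t) = 0 := fun t => by
    induction t using RTensor.induction_on with
    | h0 => simp
    | ht m a =>
      rw [RTensor.map_tmul, RTensor.map_tmul, h.apply_apply_eq_zero]
      exact (RTensor.tmulHom (R := R) (A := C) m).map_zero
    | hadd s t hs ht => simp [hs, ht]
  refine fun t => ⟨fun ht => ?_, by rintro ⟨s, rfl⟩; exact hzero s⟩
  let Q := RTensor R M B ⧸ (RTensor.map M f).range
  have hs : ∀ m b b', g b = g b' → (QuotientAddGroup.mk (RTensor.tmul R m b) : Q) =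
      QuotientAddGroup.mk (RTensor.tmul R m b') := fun m b b' hb => by
    obtain ⟨a, ha⟩ := (h (b - b')).1 (by simp [hb])
    refine QuotientAddGroup.eq_iff_sub_mem.2 ⟨RTensor.tmul R m a, ?_⟩
    rw [RTensor.map_tmul, ha]
    exact (RTensor.tmulHom m).map_sub b b'
  let σ := Function.surjInv hg
  have hσ : ∀ c, g (σ c) = c := Function.surjInv_eq hg
  let φ : M →+ C →+ Q := AddMonoidHom.mk'
    (fun m => AddMonoidHom.mk' (fun c => (QuotientAddGroup.mk (RTensor.tmul R m (σ c)) : Q))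
      fun c c' => by
        rw [hs m (σ (c + c')) (σ c + σ c') (by simp [hσ]), RTensor.tmul_add]
        rfl)
    fun m m' => by
      ext c
      change (QuotientAddGroup.mk (RTensor.tmul R (m + m') (σ c)) : Q) = _
      rw [RTensor.add_tmul]
      rfl
  have hφ : ∀ m (r : R) c, φ (MulOpposite.op r • m) c = φ m (r • c) := fun m r c => by
    change (QuotientAddGroup.mk (RTensor.tmul R (MulOpposite.op r • m) (σ c)) : Q) =
      QuotientAddGroup.mk (RTensor.tmul R m (σ (r • c)))
    rw [← RTensor.tmul_smul]
    exact hs _ _ _ (by simp [hσ])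
  have key : ∀ t, RTensor.lift φ hφ (RTensor.map M g t) = (QuotientAddGroup.mk t : Q) := fun t => by
    induction t using RTensor.induction_on with
    | h0 => simp
    | ht m b =>
      rw [RTensor.map_tmul, RTensor.lift_tmul]
      exact hs _ _ _ (hσ _)
    | hadd s t hs ht =>
      rw [map_add, map_add, hs, ht]
      rfl
  have := key t
  rw [ht, map_zero] at this
  exact (QuotientAddGroup.eq_zero_iff t).1 this.symm

end

end Tensor

/-! ### Injectivity after tensoring and solvability of systems -/

section TensorCriterion

variable {R : Type w} [Ring R]

lemma ReflectsSystems.of_fintype {A B : Type*} [AddCommGroup A] [Module R A] [AddCommGroup B]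
    [Module R B] {f : A →ₗ[R] B} (hf : ReflectsSystems f) {ι κ : Type*} [Fintype ι] [Fintype κ]
    (a : ι → κ → R) (x : ι → A) (b : κ → B) (hx : ∀ i, f (x i) = ∑ j, a i j • b j) :
    ∃ y : κ → A, ∀ i, x i = ∑ j, a i j • y j := by
  let e := Fintype.equivFin ι
  let e' := Fintype.equivFin κ
  obtain ⟨y, hy⟩ := hf _ _ (fun i j => a (e.symm i) (e'.symm j)) (fun i => x (e.symm i))
    (fun j => b (e'.symm j))
    fun i => (hx _).trans (e'.symm.sum_comp fun j => a (e.symm i) j • b j).symm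
  refine ⟨fun j => y (e' j), fun i => ?_⟩
  have := hy (e i)
  rw [← e'.sum_comp] at this
  simpa using this

/-- The test module is `M`, the cokernel of the matrix `a` on columns over `R`: the class of `x` in
`A^m / a A^n` is read off from the element `∑ eᵢ ⊗ xᵢ` of `M ⊗ A`, and solvability in `B` forces
this element to die in `M ⊗ B`. -/
lemma reflectsSystems_of_injective_map {A B : Type v} [AddCommGroup A] [Module R A]
    [AddCommGroup B] [Module R B] {f : A →ₗ[R] B}
    (hf : ∀ (M : Type (max w v)) [AddCommGroup M] [Module Rᵐᵒᵖ M],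
      Function.Injective (RTensor.map M f)) : ReflectsSystems f := by
  intro m n a x b hx
  let ρ : (Fin n → R) →ₗ[Rᵐᵒᵖ] (Fin m → R) :=
    { toFun := fun s i => ∑ j, a i j * s j
      map_add' := fun s s' => by ext i; simp [mul_add, Finset.sum_add_distrib]
      map_smul' := fun r s => by
        ext i
        simp [Finset.sum_mul, mul_assoc] }
  -- The lift only places the test module in the universe over which the hypothesis quantifies.
  let M := ULift.{v} ((Fin m → R) ⧸ LinearMap.range ρ)
  let π : (Fin m → R) →ₗ[Rᵐᵒᵖ] M :=
    ULift.moduleEquiv.symm.toLinearMap ∘ₗ (LinearMap.range ρ).mkQ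
  have hπ : Function.Surjective π :=
    ULift.moduleEquiv.symm.surjective.comp (Submodule.mkQ_surjective _)
  have hker : ∀ r, π r = 0 ↔ ∃ s, ρ s = r := fun r => by
    rw [show π r = ULift.moduleEquiv.symm ((LinearMap.range ρ).mkQ r) from rfl,
      LinearEquiv.map_eq_zero_iff, Submodule.mkQ_apply, Submodule.Quotient.mk_eq_zero,
      LinearMap.mem_range]
  let σ : (Fin n → A) →+ (Fin m → A) := AddMonoidHom.mk' (fun y i => ∑ j, a i j • y j)
    fun y y' => by ext i; simp [Finset.sum_add_distrib]
  let Q := (Fin m → A) ⧸ σ.range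
  let φ₀ : (Fin m → R) →+ A →+ Q := AddMonoidHom.mk'
    (fun r => AddMonoidHom.mk' (fun x => (QuotientAddGroup.mk (fun i => r i • x) : Q))
      fun x x' => by
        rw [← QuotientAddGroup.mk_add]
        congr 1
        ext i
        simp)
    fun r r' => by
      ext x
      change (QuotientAddGroup.mk _ : Q) = QuotientAddGroup.mk _ + QuotientAddGroup.mk _
      rw [← QuotientAddGroup.mk_add]
      congr 1
      ext i
      simp [add_smul]
  have hφ₀ : φ₀ ∈ {g : (Fin m → R) →+ A →+ Q | π.toAddMonoidHom.ker ≤ g.ker} := by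
    intro r hr
    obtain ⟨s, rfl⟩ := (hker r).1 hr
    refine AddMonoidHom.ext fun x => ?_
    refine (QuotientAddGroup.eq_zero_iff _).2 ⟨fun j => s j • x, ?_⟩
    ext i
    simp [σ, ρ, Finset.sum_smul, mul_smul]
  let φ : M →+ A →+ Q := π.toAddMonoidHom.liftOfSurjective hπ ⟨φ₀, hφ₀⟩
  have hφπ : ∀ r, φ (π r) = φ₀ r := fun r =>
    AddMonoidHom.liftOfRightInverse_comp_apply _ _ (Function.rightInverse_surjInv hπ) ⟨φ₀, hφ₀⟩ r
  have hφ : ∀ p (r : R) x, φ (MulOpposite.op r • p) x = φ p (r • x) := fun p r x => by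
    obtain ⟨p, rfl⟩ := hπ p
    rw [← map_smul, hφπ, hφπ]
    change (QuotientAddGroup.mk _ : Q) = QuotientAddGroup.mk _
    congr 1
    ext i
    simp [mul_smul]
  let e : Fin m → M := fun i => π (Pi.single i 1)
  have he : ∀ s : Fin m → R, π s = ∑ i, MulOpposite.op (s i) • e i := fun s => by
    simp only [e, ← map_smul, ← map_sum]
    congr 1
    ext k
    simp [Finset.sum_apply, Pi.single_apply]
  have hzero : (∑ i, RTensor.tmul R (e i) (x i)) = 0 := by
    refine (injective_iff_map_eq_zero (RTensor.map M f)).1 (hf M) _ ?_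
    have h1 : ∀ i, RTensor.map M f (RTensor.tmul R (e i) (x i)) =
        ∑ j, RTensor.tmul R (MulOpposite.op (a i j) • e i) (b j) := fun i => by
      rw [RTensor.map_tmul, hx]
      exact (map_sum (RTensor.tmulHom (R := R) (A := B) (e i)) _ _).trans
        (Finset.sum_congr rfl fun j _ => RTensor.tmul_smul _ _ _)
    -- After exchanging the sums, the `j`-th summand is `(∑ᵢ eᵢ aᵢⱼ) ⊗ bⱼ`, and `∑ᵢ eᵢ aᵢⱼ` is the
    -- class of the `j`-th column of `a`, a relation in `M`.
    rw [map_sum, Finset.sum_congr rfl fun i _ => h1 i, Finset.sum_comm]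
    refine Finset.sum_eq_zero fun j _ => ?_
    let τ : M →+ RTensor R M B := AddMonoidHom.mk' (fun p => RTensor.tmul R p (b j))
      fun p p' => RTensor.add_tmul p p' _
    have h2 : ∑ i, MulOpposite.op (a i j) • e i = 0 := by
      rw [← he fun i => a i j]
      exact (hker _).2 ⟨Pi.single j 1, by ext i; simp [ρ, Pi.single_apply]⟩
    have := map_sum τ (fun i => MulOpposite.op (a i j) • e i) Finset.univ
    rw [h2, map_zero] at this
    exact this.symm
  have hmk : (QuotientAddGroup.mk x : Q) = 0 := by
    have h3 := congrArg (RTensor.lift φ hφ) hzero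
    rw [map_sum, map_zero] at h3
    rw [← h3]
    have h4 : ∀ i, RTensor.lift φ hφ (RTensor.tmul R (e i) (x i)) =
        (QuotientAddGroup.mk (Pi.single i (x i)) : Q) := fun i => by
      rw [RTensor.lift_tmul, hφπ]
      change (QuotientAddGroup.mk _ : Q) = QuotientAddGroup.mk _
      congr 1
      ext k
      by_cases hk : k = i
      · subst hk; simp
      · simp [hk]
    rw [Finset.sum_congr rfl fun i _ => h4 i]
    refine Eq.trans ?_ (map_sum (QuotientAddGroup.mk' σ.range) _ _)
    rw [Finset.univ_sum_single]
    rfl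
  obtain ⟨y, hy⟩ := (QuotientAddGroup.eq_zero_iff _).1 hmk
  exact ⟨y, fun i => (congrFun hy i).symm⟩

section Presentation

variable (R) (M : Type*) [AddCommGroup M] [Module Rᵐᵒᵖ M]

/-- The relations defining `M ⊗_R A` as a quotient of the direct sum of copies of `A` indexed
by `M`. -/
def tensorRel (A : Type*) [AddCommGroup A] [Module R A] : (M × M) ⊕ (M × R) → A →+ (M →₀ A)
  | .inl p => Finsupp.singleAddHom (p.1 + p.2) - Finsupp.singleAddHom p.1 -
      Finsupp.singleAddHom p.2
  | .inr p => Finsupp.singleAddHom (MulOpposite.op p.2 • p.1) -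
      (Finsupp.singleAddHom p.1).comp (DistribSMul.toAddMonoidHom A p.2)

/-- The relations have coefficients in `R` that do not depend on `A`. Hence a finite combination of
them is the right-hand side of a linear system. -/
lemma tensorRel_apply {A : Type*} [AddCommGroup A] [Module R A] (j : (M × M) ⊕ (M × R)) (a : A)
    (m : M) : tensorRel R M A j a m = tensorRel R M R j 1 m • a := by
  classical
  rcases j with p | p <;>
  simp [tensorRel, Finsupp.single_apply, sub_smul]

end Presentation

/-- An element of `M ⊗ A` that dies in `M ⊗ B` is represented by a finitely supported family whose
image is a finite combination of relations over `B`. This is a finite system solvable in `B`; a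
solution in `A` exhibits the family as a combination of relations over `A`. -/
lemma ReflectsSystems.injective_map {A B : Type*} [AddCommGroup A] [Module R A]
    [AddCommGroup B] [Module R B] {f : A →ₗ[R] B} (hf : ReflectsSystems f)
    (M : Type*) [AddCommGroup M] [Module Rᵐᵒᵖ M] : Function.Injective (RTensor.map M f) := by
  classical
  let Θ : (M →₀ A) →+ RTensor R M A := Finsupp.liftAddHom fun m => RTensor.tmulHom m
  have hΘ : ∀ m a, Θ (Finsupp.single m a) = RTensor.tmul R m a := fun m a =>
    Finsupp.liftAddHom_apply_single _ _ _
  have hΘs : Function.Surjective Θ := fun t => by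
    induction t using RTensor.induction_on with
    | h0 => exact ⟨0, map_zero _⟩
    | ht m a => exact ⟨_, hΘ m a⟩
    | hadd s t hs ht =>
      obtain ⟨s, rfl⟩ := hs
      obtain ⟨t, rfl⟩ := ht
      exact ⟨s + t, map_add _ _ _⟩
  have hΘr : ∀ j a, Θ (tensorRel R M A j a) = 0 := by
    rintro (p | p) a
    · simp [tensorRel, hΘ, RTensor.add_tmul]
    · simp [tensorRel, hΘ, RTensor.tmul_smul]
  let Ψ : ((M × M) ⊕ (M × R) →₀ B) →+ (M →₀ B) := Finsupp.liftAddHom (tensorRel R M B)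
  let Q := (M →₀ B) ⧸ Ψ.range
  have hrel : ∀ j b, (QuotientAddGroup.mk (tensorRel R M B j b) : Q) = 0 := fun j b =>
    (QuotientAddGroup.eq_zero_iff _).2 ⟨Finsupp.single j b, Finsupp.liftAddHom_apply_single _ _ _⟩
  let q : (M →₀ B) →+ Q := QuotientAddGroup.mk' Ψ.range
  let φ : M →+ B →+ Q := AddMonoidHom.mk' (fun m => q.comp (Finsupp.singleAddHom m))
    fun m m' => by
      refine AddMonoidHom.ext fun b => ?_
      have := hrel (.inl (m, m')) b
      change q (Finsupp.single (m + m') b - Finsupp.single m b - Finsupp.single m' b) = 0 at this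
      rw [map_sub, map_sub, sub_sub, sub_eq_zero] at this
      exact this
  have hφ : ∀ m (r : R) b, φ (MulOpposite.op r • m) b = φ m (r • b) := fun m r b => by
    have := hrel (.inr (m, r)) b
    change q (Finsupp.single (MulOpposite.op r • m) b - Finsupp.single m (r • b)) = 0 at this
    rwa [map_sub, sub_eq_zero] at this
  have hcomp : ∀ x : M →₀ A, RTensor.lift φ hφ (RTensor.map M f (Θ x)) =
      q (x.mapRange f (map_zero f)) := fun x => by
    induction x using Finsupp.induction_linear with
    | zero => simp
    | add x y hx hy =>
      rw [map_add, map_add, map_add, hx, hy, ← map_add, Finsupp.mapRange_add (map_add f)]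
    | single m a =>
      rw [hΘ, RTensor.map_tmul, RTensor.lift_tmul, Finsupp.mapRange_single]
      rfl
  refine (injective_iff_map_eq_zero _).2 fun t ht => ?_
  obtain ⟨x, rfl⟩ := hΘs t
  have hx := hcomp x
  rw [ht, map_zero] at hx
  obtain ⟨β, hβ⟩ := (QuotientAddGroup.eq_zero_iff _).1 hx.symm
  let rel : (M × M) ⊕ (M × R) → M →₀ R := fun j => tensorRel R M R j 1
  have hβ' : ∀ m, f (x m) = ∑ j : β.support, rel j m • β j := fun m => by
    have := DFunLike.congr_fun hβ m
    rw [Finsupp.mapRange_apply] at this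
    rw [← this, Finset.sum_coe_sort β.support fun j => rel j m • β j]
    change (Finsupp.sum β fun j b => tensorRel R M B j b) m = _
    rw [Finsupp.sum, Finsupp.finsetSum_apply]
    exact Finset.sum_congr rfl fun j _ => tensorRel_apply R M j (β j) m
  -- Outside `I` both the family and all relations involved vanish, so finitely many equations
  -- suffice.
  let I : Finset M := x.support ∪ β.support.biUnion fun j => (rel j).support
  obtain ⟨y, hy⟩ := hf.of_fintype (fun (m : I) (j : β.support) => rel j m) (fun m => x m)
    (fun j => β j) fun m => hβ' m
  have hxy : x = ∑ j : β.support, tensorRel R M A j (y j) := by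
    ext m
    rw [Finsupp.finsetSum_apply, Finset.sum_congr rfl fun j _ => tensorRel_apply R M j.1 (y j) m]
    by_cases hm : m ∈ I
    · exact hy ⟨m, hm⟩
    · simp only [I, Finset.mem_union, Finset.mem_biUnion, not_or, not_exists, not_and,
        Finsupp.notMem_support_iff] at hm
      rw [hm.1]
      exact (Finset.sum_eq_zero fun j _ => by
        rw [show tensorRel R M R j 1 m = 0 from hm.2 j j.2, zero_smul]).symm
  rw [hxy, map_sum]
  exact Finset.sum_eq_zero fun j _ => hΘr _ _

end TensorCriterion

/-! ### Pure monomorphisms, pure epimorphisms and pure decompositions -/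

section Purity

variable {R : Type w} [Ring R]

lemma shortExact_function (S : ShortComplex (ModuleCat.{v} R)) :
    S.ShortExact ↔ Function.Injective S.f.hom ∧ Function.Exact S.f.hom S.g.hom ∧
      Function.Surjective S.g.hom := by
  constructor
  · intro h
    exact ⟨(ModuleCat.mono_iff_injective _).1 h.mono_f,
      (ShortComplex.ShortExact.moduleCat_exact_iff_function_exact S).1 h.exact,
      (ModuleCat.epi_iff_surjective _).1 h.epi_g⟩
  · rintro ⟨h1, h2, h3⟩
    exact { exact := (ShortComplex.ShortExact.moduleCat_exact_iff_function_exact S).2 h2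
            mono_f := (ModuleCat.mono_iff_injective _).2 h1
            epi_g := (ModuleCat.epi_iff_surjective _).2 h3 }

lemma isPureShortExact_iff_reflectsSystems {S : ShortComplex (ModuleCat.{v} R)} :
    IsPureShortExact S ↔ S.ShortExact ∧ ReflectsSystems S.f.hom := by
  refine ⟨fun h => ⟨h.1, reflectsSystems_of_injective_map fun M _ _ => (h.2 M).1⟩,
    fun h => ⟨h.1, fun M _ _ => ?_⟩⟩
  have := (shortExact_function S).1 h.1
  exact ⟨h.2.injective_map M, RTensor.map_exact this.2.1 this.2.2,
    RTensor.map_surjective this.2.2⟩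

lemma isPureShortExact_iff_liftsSystems {S : ShortComplex (ModuleCat.{v} R)} :
    IsPureShortExact S ↔ S.ShortExact ∧ LiftsSystems S.g.hom := by
  rw [isPureShortExact_iff_reflectsSystems]
  refine and_congr_right fun h => ?_
  have := (shortExact_function S).1 h
  exact ⟨fun h' => h'.liftsSystems this.2.1 this.2.2,
    fun h' => h'.reflectsSystems this.2.1 this.1⟩

lemma isPureEpi_iff {B C : ModuleCat.{v} R} {g : B ⟶ C} : IsPureEpi g ↔ LiftsSystems g.hom := by
  constructor
  · rintro ⟨A, f, h, hS⟩
    exact (isPureShortExact_iff_liftsSystems.1 hS).2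
  · intro h
    refine ⟨ModuleCat.of R (LinearMap.ker g.hom), ModuleCat.ofHom (LinearMap.ker g.hom).subtype,
      by ext x; exact x.2, isPureShortExact_iff_liftsSystems.2
      ⟨(shortExact_function _).2 ⟨Subtype.val_injective, fun x => ?_, h.surjective⟩, h⟩⟩
    simp

lemma isPureMono_iff {A B : ModuleCat.{v} R} {f : A ⟶ B} :
    IsPureMono f ↔ ReflectsSystems f.hom := by
  constructor
  · rintro ⟨A, f, h, hS⟩
    exact (isPureShortExact_iff_reflectsSystems.1 hS).2
  · intro h
    refine ⟨ModuleCat.of R (B ⧸ LinearMap.range f.hom),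
      ModuleCat.ofHom (LinearMap.range f.hom).mkQ, ?_, isPureShortExact_iff_reflectsSystems.2
      ⟨(shortExact_function _).2 ⟨h.injective, fun x => ?_, Submodule.mkQ_surjective _⟩, h⟩⟩
    · ext x
      simp
    · simp [Submodule.Quotient.mk_eq_zero]

/-- The intermediate module has to be the image of `d`, so both purity conditions can be phrased
with elements of the form `d x`. -/
lemma hasPureDecomposition_iff {A B : ModuleCat.{v} R} {d : A ⟶ B} :
    HasPureDecomposition d ↔
      (∀ (m n : ℕ) (a : Fin m → Fin n → R) (x : Fin n → A),
        (∀ i, ∑ j, a i j • d.hom (x j) = 0) →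
          ∃ y : Fin n → A, (∀ i, ∑ j, a i j • y j = 0) ∧ ∀ j, d.hom (y j) = d.hom (x j)) ∧
      (∀ (m n : ℕ) (a : Fin m → Fin n → R) (x : Fin m → A) (b : Fin n → B),
        (∀ i, d.hom (x i) = ∑ j, a i j • b j) →
          ∃ y : Fin n → A, ∀ i, d.hom (x i) = ∑ j, a i j • d.hom (y j)) := by
  constructor
  · rintro ⟨D, p, j, hp, hj, rfl⟩
    rw [isPureEpi_iff] at hp
    rw [isPureMono_iff] at hj
    simp only [ModuleCat.hom_comp, LinearMap.comp_apply]
    constructor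
    · intro m n a x hx
      obtain ⟨y, hy, hy'⟩ := hp m n a (fun k => p.hom (x k)) fun i => hj.injective (by simp [hx])
      exact ⟨y, hy, fun k => by rw [hy']⟩
    · intro m n a x b hb
      obtain ⟨y, hy⟩ := hj m n a _ b hb
      choose z hz using fun k => hp.surjective (y k)
      exact ⟨z, fun i => by simp [hy, hz]⟩
  · rintro ⟨h1, h2⟩
    refine ⟨ModuleCat.of R (LinearMap.range d.hom), ModuleCat.ofHom d.hom.rangeRestrict,
      ModuleCat.ofHom (LinearMap.range d.hom).subtype, isPureEpi_iff.2 ?_, isPureMono_iff.2 ?_,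
      rfl⟩
    · intro m n a c hc
      choose x hx using fun j => (c j).2
      obtain ⟨y, hy, hy'⟩ := h1 m n a x fun i => by
        simpa [hx] using congrArg Subtype.val (hc i)
      exact ⟨y, hy, fun j => Subtype.ext ((hy' j).trans (hx j))⟩
    · intro m n a c b hb
      choose x hx using fun j => (c j).2
      obtain ⟨y, hy⟩ := h2 m n a x b fun i => (hx i).trans (hb i)
      refine ⟨fun j => d.hom.rangeRestrict (y j), fun i => Subtype.ext ?_⟩
      rw [← hx, hy]
      simp

end Purity

/-! ### Pure exactness of complexes, elementwise -/

section Complexes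

variable {R : Type w} [Ring R]

/-- Every tuple of cocycles of degree `k` which solves a finite homogeneous system is the
differential of a solution. Equivalently, `Hom(F, X)` is exact in degree `k` for all finitely
presented `F`. -/
def HomExactAt (X : CochainComplex (ModuleCat.{v} R) ℤ) (k : ℤ) : Prop :=
  ∀ (m n : ℕ) (a : Fin m → Fin n → R) (x : Fin n → X.X k), (∀ i, ∑ j, a i j • x j = 0) →
    (∀ j, (X.d k (k + 1)).hom (x j) = 0) →
      ∃ y : Fin n → X.X (k - 1), (∀ i, ∑ j, a i j • y j = 0) ∧
        ∀ j, (X.d (k - 1) k).hom (y j) = x j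

/-- Equivalently, `M ⊗ X` is exact in degree `k` for all finitely presented `M`. -/
def TensorExactAt (X : CochainComplex (ModuleCat.{v} R) ℤ) (k : ℤ) : Prop :=
  ∀ (m n : ℕ) (a : Fin m → Fin n → R) (x : Fin m → X.X k) (b : Fin n → X.X (k + 1)),
    (∀ i, (X.d k (k + 1)).hom (x i) = ∑ j, a i j • b j) →
      ∃ (y : Fin n → X.X k) (z : Fin m → X.X (k - 1)),
        ∀ i, x i = ∑ j, a i j • y j + (X.d (k - 1) k).hom (z i)

/-- The differential `X^k → X^{k+1}` is pure epic onto its image. -/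
def PureOntoImageAt (X : CochainComplex (ModuleCat.{v} R) ℤ) (k : ℤ) : Prop :=
  ∀ (m n : ℕ) (a : Fin m → Fin n → R) (x : Fin n → X.X k),
    (∀ i, ∑ j, a i j • (X.d k (k + 1)).hom (x j) = 0) →
      ∃ y : Fin n → X.X k, (∀ i, ∑ j, a i j • y j = 0) ∧
        ∀ j, (X.d k (k + 1)).hom (y j) = (X.d k (k + 1)).hom (x j)

variable {X : CochainComplex (ModuleCat.{v} R) ℤ} {k : ℤ}

lemma d_d_apply (X : CochainComplex (ModuleCat.{v} R) ℤ) (i j k : ℤ) (x : X.X i) :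
    (X.d j k).hom ((X.d i j).hom x) = 0 := by
  rw [← LinearMap.comp_apply, ← ModuleCat.hom_comp, X.d_comp_d]
  rfl

lemma HomExactAt.exists_lift (h : HomExactAt X k) {i l : ℤ} (hi : i + 1 = k) (hl : k + 1 = l)
    {m n : ℕ} (a : Fin m → Fin n → R) (x : Fin n → X.X k) (hx : ∀ i, ∑ j, a i j • x j = 0)
    (hd : ∀ j, (X.d k l).hom (x j) = 0) :
    ∃ y : Fin n → X.X i, (∀ i, ∑ j, a i j • y j = 0) ∧ ∀ j, (X.d i k).hom (y j) = x j := by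
  obtain rfl : i = k - 1 := by lia
  subst hl
  exact h m n a x hx hd

lemma TensorExactAt.exists_eq (h : TensorExactAt X k) {i l : ℤ} (hi : i + 1 = k)
    (hl : k + 1 = l) {m n : ℕ} (a : Fin m → Fin n → R) (x : Fin m → X.X k) (b : Fin n → X.X l)
    (hx : ∀ i, (X.d k l).hom (x i) = ∑ j, a i j • b j) :
    ∃ (y : Fin n → X.X k) (z : Fin m → X.X i),
      ∀ s, x s = ∑ j, a s j • y j + (X.d i k).hom (z s) := by
  obtain rfl : i = k - 1 := by lia
  subst hl
  exact h m n a x b hx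

lemma HomExactAt.exists_d_eq (h : HomExactAt X k) {i l : ℤ} (hi : i + 1 = k) (hl : k + 1 = l)
    (x : X.X k) (hx : (X.d k l).hom x = 0) : ∃ y, (X.d i k).hom y = x := by
  obtain ⟨y, -, hy⟩ := h.exists_lift hi hl (m := 0) (n := 1) (fun _ _ => 0) (fun _ => x)
    (fun i => i.elim0) fun _ => hx
  exact ⟨y 0, hy 0⟩

lemma TensorExactAt.exists_d_eq (h : TensorExactAt X k) {i l : ℤ} (hi : i + 1 = k)
    (hl : k + 1 = l) (x : X.X k) (hx : (X.d k l).hom x = 0) : ∃ y, (X.d i k).hom y = x := by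
  obtain ⟨y, z, hz⟩ := h.exists_eq hi hl (m := 1) (n := 0) (fun _ _ => 0) (fun _ => x)
    (fun i => i.elim0) fun _ => by simpa using hx
  exact ⟨z 0, by simpa using (hz 0).symm⟩

lemma HomExactAt.pureOntoImageAt {l : ℤ} (hl : k + 1 = l) (h : HomExactAt X l) :
    PureOntoImageAt X k := by
  subst hl
  intro m n a x hx
  exact h.exists_lift rfl rfl a (fun j => (X.d k (k + 1)).hom (x j)) hx fun j => d_d_apply ..

/-- Exactness in degree `k + 2` replaces `b` by a homogeneous solution `b'` with the same
differential; then `b - b'` is the differential of some `c`, and `x - a c` is a cocycle. -/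
lemma HomExactAt.tensorExactAt (h : HomExactAt X k) (h₁ : HomExactAt X (k + 1))
    (h₂ : HomExactAt X (k + 1 + 1)) : TensorExactAt X k := by
  intro m n a x b hx
  obtain ⟨b', hb', hd⟩ := h₂.pureOntoImageAt rfl m n a b fun i => by
    have := congrArg (X.d (k + 1) (k + 1 + 1)).hom (hx i)
    simpa [d_d_apply] using this.symm
  choose c hc using fun j => h₁.exists_d_eq rfl rfl (b j - b' j) (by simp [hd])
  choose z hz using fun i => h.exists_d_eq (i := k - 1) (by lia) rfl
    (x i - ∑ j, a i j • c j) (by simp [hc, hx, smul_sub, hb'])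
  exact ⟨c, z, fun i => by simp [hz]⟩

/-- The errors `∑ a x` are differentials of some `v`; the tensor condition one degree lower writes
`v` as `a y` plus boundaries, and `x - d y` is the desired solution. -/
lemma TensorExactAt.pureOntoImageAt {i : ℤ} (hi : i + 1 = k) (h : TensorExactAt X k)
    (h' : TensorExactAt X i) : PureOntoImageAt X k := by
  intro m n a x hx
  choose v hv using fun s => h.exists_d_eq hi rfl (∑ j, a s j • x j) (by simp [hx])
  obtain ⟨y, z, hy⟩ := h'.exists_eq (i := i - 1) (by lia) hi a v x hv
  refine ⟨fun j => x j - (X.d i k).hom (y j), fun s => ?_, fun j => by simp [d_d_apply]⟩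
  simp [smul_sub, Finset.sum_sub_distrib, ← hv, hy, d_d_apply]

lemma PureOntoImageAt.exists_eq (h : PureOntoImageAt X k) {l : ℤ} (hl : k + 1 = l) {m n : ℕ}
    (a : Fin m → Fin n → R) (x : Fin n → X.X k)
    (hx : ∀ i, ∑ j, a i j • (X.d k l).hom (x j) = 0) :
    ∃ y : Fin n → X.X k, (∀ i, ∑ j, a i j • y j = 0) ∧
      ∀ j, (X.d k l).hom (y j) = (X.d k l).hom (x j) := by
  subst hl
  exact h m n a x hx

lemma TensorExactAt.homExactAt {i j : ℤ} (hi : i + 1 = j) (hj : j + 1 = k)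
    (h : TensorExactAt X k) (h₁ : TensorExactAt X j) (h₂ : TensorExactAt X i) :
    HomExactAt X k := by
  obtain rfl : j = k - 1 := by lia
  intro m n a x hx hd
  choose w hw using fun s => h.exists_d_eq hj rfl (x s) (hd s)
  obtain ⟨y, hy, hy'⟩ := (h₁.pureOntoImageAt hi h₂).exists_eq hj a w fun s => by simp [hw, hx]
  exact ⟨y, hy, fun s => (hy' s).trans (hw s)⟩

lemma range_kernel_ι {A B : ModuleCat.{v} R} (d : A ⟶ B) (x : A) :
    (∃ y, (kernel.ι d).hom y = x) ↔ d.hom x = 0 := by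
  constructor
  · rintro ⟨y, rfl⟩
    rw [← LinearMap.comp_apply, ← ModuleCat.hom_comp, kernel.condition]
    rfl
  · intro hx
    refine ⟨(ModuleCat.kernelIsoKer d).inv.hom ⟨x, hx⟩, ?_⟩
    rw [← LinearMap.comp_apply, ← ModuleCat.hom_comp, ModuleCat.kernelIsoKer_inv_kernel_ι]
    rfl

lemma ker_cokernel_π {A B : ModuleCat.{v} R} (d : A ⟶ B) (x : B) :
    (cokernel.π d).hom x = 0 ↔ ∃ y, d.hom y = x := by
  have h : (ModuleCat.cokernelIsoRangeQuotient d).hom.hom ((cokernel.π d).hom x) =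
      (LinearMap.range d.hom).mkQ x := by
    rw [← LinearMap.comp_apply, ← ModuleCat.hom_comp,
      ModuleCat.cokernel_π_cokernelIsoRangeQuotient_hom]
    rfl
  rw [← LinearMap.mem_range, ← Submodule.Quotient.mk_eq_zero, ← Submodule.mkQ_apply, ← h]
  exact (map_eq_zero_iff _
    ((ModuleCat.mono_iff_injective (ModuleCat.cokernelIsoRangeQuotient d).hom).1
      inferInstance)).symm

lemma isPureExactAt_iff : IsPureExactAt X k ↔
    HomExactAt X k ∧ TensorExactAt X k ∧ PureOntoImageAt X k := by
  constructor
  · rintro ⟨h₁, h₂, h, hS⟩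
    rw [hasPureDecomposition_iff] at h₁ h₂
    have hex : ∀ x, (X.d k (k + 1)).hom x = 0 → ∃ y, (X.d (k - 1) k).hom y = x := fun x hx => by
      obtain ⟨z, rfl⟩ := (range_kernel_ι _ x).2 hx
      exact (ker_cokernel_π _ _).1 (((shortExact_function _).1 hS.1).2.1.apply_apply_eq_zero z)
    refine ⟨fun m n a x hx hd => ?_, fun m n a x b hx => ?_, h₂.1⟩
    · choose w hw using fun j => hex _ (hd j)
      obtain ⟨y, hy, hy'⟩ := h₁.1 m n a w fun i => by simp [hw, hx]
      exact ⟨y, hy, fun j => (hy' j).trans (hw j)⟩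
    · obtain ⟨y, hy⟩ := h₂.2 m n a x b hx
      choose z hz using fun i => hex (x i - ∑ j, a i j • y j) (by simp [hy])
      exact ⟨y, z, fun i => by simp [hz]⟩
  · rintro ⟨hH, hT, hK⟩
    have hprev : (k - 1) + 1 = k := by lia
    have hex := fun x hx => hH.exists_d_eq hprev rfl x hx
    have hdiff : ∀ (m n : ℕ) (a : Fin m → Fin n → R) (x : Fin m → X.X k) (b : Fin n → X.X k),
        (∀ i, (X.d k (k + 1)).hom (x i) = 0) → (∀ i, x i = ∑ j, a i j • b j) →
          ∃ y : Fin n → X.X (k - 1), ∀ i, x i = ∑ j, a i j • (X.d (k - 1) k).hom (y j) := by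
      intro m n a x b hd hx
      obtain ⟨b', hb', hd'⟩ := hK m n a b fun i => by
        have := hd i
        rwa [hx, map_sum, Finset.sum_congr rfl fun j _ => map_smul _ _ _] at this
      choose y hy using fun j => hex (b j - b' j) (by simp [hd'])
      exact ⟨y, fun i => by simp [hy, smul_sub, Finset.sum_sub_distrib, hb', hx]⟩
    have hzero : kernel.ι (X.d k (k + 1)) ≫ cokernel.π (X.d (k - 1) k) = 0 := by
      ext z
      exact (ker_cokernel_π _ _).2 (hex _ ((range_kernel_ι _ _).1 ⟨z, rfl⟩))
    refine ⟨hasPureDecomposition_iff.2 ⟨fun m n a x hx => ?_, fun m n a x b hx => ?_⟩,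
      hasPureDecomposition_iff.2 ⟨hK, fun m n a x b hx => ?_⟩, hzero,
      isPureShortExact_iff_reflectsSystems.2 ⟨(shortExact_function _).2
        ⟨(ModuleCat.mono_iff_injective _).1 inferInstance, fun x => ?_,
          (ModuleCat.epi_iff_surjective _).1 inferInstance⟩, fun m n a x b hx => ?_⟩⟩
    · exact hH m n a _ hx fun j => d_d_apply ..
    · exact hdiff m n a _ b (fun i => d_d_apply ..) hx
    · obtain ⟨y, z, hy⟩ := hT m n a x b hx
      exact ⟨y, fun i => by simp [hy, d_d_apply]⟩
    · exact (ker_cokernel_π _ _).trans ⟨fun ⟨y, hy⟩ => (range_kernel_ι _ _).2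
        (by rw [← hy, d_d_apply]), fun hx => hex _ ((range_kernel_ι _ _).1 hx)⟩
    · obtain ⟨y, hy⟩ := hdiff m n a _ b (fun i => (range_kernel_ι _ _).1 ⟨x i, rfl⟩) hx
      choose z hz using fun j => (range_kernel_ι (X.d k (k + 1)) ((X.d (k - 1) k).hom (y j))).2
        (d_d_apply ..)
      refine ⟨z, fun i => (ModuleCat.mono_iff_injective (kernel.ι _)).1 inferInstance ?_⟩
      refine (hy i).trans ?_
      rw [map_sum]
      exact Finset.sum_congr rfl fun j _ => by rw [← hz]; exact (map_smul _ _ _).symm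

lemma isPureExact_iff_homExactAt : IsPureExact X ↔ ∀ k, HomExactAt X k :=
  ⟨fun h k => (isPureExactAt_iff.1 (h k)).1, fun h k => isPureExactAt_iff.2
    ⟨h k, (h k).tensorExactAt (h _) (h _), (h _).pureOntoImageAt rfl⟩⟩

/-- The Hom condition in degree `k` follows from the tensor condition in degrees `k`, `k - 1`, `k -
2`. Only lower degrees enter, so half-lines unbounded below are stable. -/
lemma forall_isPureExactAt_iff_tensorExactAt (N : ℤ) :
    (∀ k < N, IsPureExactAt X k) ↔ ∀ k < N, TensorExactAt X k :=
  ⟨fun h k hk => (isPureExactAt_iff.1 (h k hk)).2.1, fun h k hk => isPureExactAt_iff.2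
    ⟨(h k hk).homExactAt (i := k - 2) (by lia) (by lia) (h (k - 1) (by lia)) (h _ (by lia)),
      h k hk, (h k hk).pureOntoImageAt (i := k - 1) (by lia) (h _ (by lia))⟩⟩

lemma isPureExact_iff_tensorExactAt : IsPureExact X ↔ ∀ k, TensorExactAt X k :=
  ⟨fun h k => (isPureExactAt_iff.1 (h k)).2.1,
    fun h k => (forall_isPureExactAt_iff_tensorExactAt (k + 1)).2 (fun j _ => h j) k (by lia)⟩

lemma le_infP_iff (N : ℤ) : ((N : ℝ) : EReal) ≤ infP X ↔ ∀ k < N, TensorExactAt X k := by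
  rw [← forall_isPureExactAt_iff_tensorExactAt, infP, le_sInf_iff]
  constructor
  · intro h k hk
    by_contra hX
    have := h _ ⟨k, hX, rfl⟩
    rw [EReal.coe_le_coe_iff, Int.cast_le] at this
    lia
  · rintro h _ ⟨k, hk, rfl⟩
    rw [EReal.coe_le_coe_iff, Int.cast_le]
    by_contra hN
    exact hk (h k (by lia))

lemma isPureExactAt_of_supP_lt {k : ℤ} (h : supP X < ((k : ℝ) : EReal)) : IsPureExactAt X k := by
  by_contra hX
  exact h.not_ge (le_sSup ⟨k, hX, rfl⟩)

lemma supP_le {N : ℤ} (h : ∀ k, N < k → IsPureExactAt X k) : supP X ≤ ((N : ℝ) : EReal) := by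
  refine sSup_le ?_
  rintro _ ⟨k, hk, rfl⟩
  rw [EReal.coe_le_coe_iff, Int.cast_le]
  by_contra hN
  exact hk (h k (by lia))

/-! ### Tensor exactness along pure quasi-isomorphisms -/

section MappingCone

open CochainComplex CochainComplex.HomComplex

variable {P : CochainComplex (ModuleCat.{v} R) ℤ} {f : P ⟶ X}

lemma cone_d_inr (i j : ℤ) (x : X.X i) :
    ((mappingCone f).d i j).hom (((mappingCone.inr f).f i).hom x) =
      ((mappingCone.inr f).f j).hom ((X.d i j).hom x) := by
  simp only [← LinearMap.comp_apply, ← ModuleCat.hom_comp, HomologicalComplex.Hom.comm]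

lemma cone_snd_inr (i : ℤ) (x : X.X i) :
    ((mappingCone.snd f).v i i (add_zero i)).hom (((mappingCone.inr f).f i).hom x) = x := by
  simp only [← LinearMap.comp_apply, ← ModuleCat.hom_comp, mappingCone.inr_f_snd_v]
  rfl

lemma cone_fst_inr (i j : ℤ) (h : i + 1 = j) (x : X.X i) :
    ((mappingCone.fst f).1.v i j h).hom (((mappingCone.inr f).f i).hom x) = 0 := by
  simp only [← LinearMap.comp_apply, ← ModuleCat.hom_comp, mappingCone.inr_f_fst_v]
  rfl

lemma cone_fst_inl (i j : ℤ) (h : i + 1 = j) (x : P.X j) :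
    ((mappingCone.fst f).1.v i j h).hom
      (((mappingCone.inl f).v j i (by lia)).hom x) = x := by
  simp only [← LinearMap.comp_apply, ← ModuleCat.hom_comp, mappingCone.inl_v_fst_v]
  rfl

lemma cone_d_inl (i j k : ℤ) (h : i + 1 = j) (h' : j + 1 = k) (x : P.X j) :
    ((mappingCone f).d i j).hom (((mappingCone.inl f).v j i (by lia)).hom x) =
      ((mappingCone.inr f).f j).hom ((f.f j).hom x) -
        ((mappingCone.inl f).v k j (by lia)).hom ((P.d j k).hom x) := by
  rw [← LinearMap.comp_apply, ← ModuleCat.hom_comp, mappingCone.inl_v_d f j i k (by lia) (by lia)]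
  rfl

lemma cone_fst_d (i j k : ℤ) (h : i + 1 = j) (h' : j + 1 = k) (x : (mappingCone f).X i) :
    ((mappingCone.fst f).1.v j k h').hom (((mappingCone f).d i j).hom x) =
      -(P.d j k).hom (((mappingCone.fst f).1.v i j h).hom x) := by
  rw [← LinearMap.comp_apply, ← ModuleCat.hom_comp, mappingCone.d_fst_v f i j k h h']
  rfl

lemma cone_snd_d (i j : ℤ) (h : i + 1 = j) (x : (mappingCone f).X i) :
    ((mappingCone.snd f).v j j (add_zero j)).hom (((mappingCone f).d i j).hom x) =
      (f.f j).hom (((mappingCone.fst f).1.v i j h).hom x) +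
        (X.d i j).hom (((mappingCone.snd f).v i i (add_zero i)).hom x) := by
  rw [← LinearMap.comp_apply, ← ModuleCat.hom_comp, mappingCone.d_snd_v f i j h]
  rfl

lemma hom_comm_apply (i j : ℤ) (x : P.X i) :
    (X.d i j).hom ((f.f i).hom x) = (f.f j).hom ((P.d i j).hom x) := by
  simp only [← LinearMap.comp_apply, ← ModuleCat.hom_comp, HomologicalComplex.Hom.comm]

/-- Tensor exactness passes along `f` in a single degree, unlike the Hom condition's half-line
comparison: this is the long exact sequence of the tensored cone, carried out with elements. -/
lemma IsPureQuasiIso.tensorExactAt_target (hf : IsPureQuasiIso f) (h : TensorExactAt P k) :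
    TensorExactAt X k := by
  have hC := isPureExact_iff_tensorExactAt.1 hf
  intro m n a x b hx
  have hprev : (k - 1) + 1 = k := by lia
  obtain ⟨c, c', hc⟩ := (hC k).exists_eq hprev rfl a
    (fun i => ((mappingCone.inr f).f k).hom (x i))
    (fun j => ((mappingCone.inr f).f (k + 1)).hom (b j)) fun i => by
      simp [cone_d_inr, hx]
  obtain ⟨q, q', hq⟩ := h.exists_eq hprev rfl a
    (fun i => ((mappingCone.fst f).1.v (k - 1) k hprev).hom (c' i))
    (fun j => ((mappingCone.fst f).1.v k (k + 1) rfl).hom (c j)) fun i => by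
      have := congrArg ((mappingCone.fst f).1.v k (k + 1) rfl).hom (hc i)
      rw [cone_fst_inr, map_add, map_sum, cone_fst_d _ _ _ hprev, ← sub_eq_add_neg, eq_comm,
        sub_eq_zero] at this
      simpa using this.symm
  refine ⟨fun j => ((mappingCone.snd f).v k k (add_zero k)).hom (c j) + (f.f k).hom (q j),
    fun i => ((mappingCone.snd f).v (k - 1) (k - 1) (add_zero _)).hom (c' i) +
      (f.f (k - 1)).hom (q' i), fun i => ?_⟩
  have := congrArg ((mappingCone.snd f).v k k (add_zero k)).hom (hc i)
  rw [cone_snd_inr, map_add, map_sum, cone_snd_d _ _ hprev, hq] at this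
  rw [this]
  simp only [map_add, map_sum, map_smul, smul_add, Finset.sum_add_distrib, hom_comm_apply]
  abel

lemma IsPureQuasiIso.tensorExactAt_source (hf : IsPureQuasiIso f) (h : TensorExactAt X k) :
    TensorExactAt P k := by
  have hC := isPureExact_iff_tensorExactAt.1 hf
  intro m n a p b hp
  have hprev : (k - 1) + 1 = k := by lia
  obtain ⟨y, z, hy⟩ := h.exists_eq hprev rfl a (fun i => (f.f k).hom (p i))
    (fun j => (f.f (k + 1)).hom (b j)) fun i => by simp [hom_comm_apply, hp]
  obtain ⟨c, c', hc⟩ := (hC (k - 1)).exists_eq (i := k - 2) (by lia) hprev a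
    (fun i => ((mappingCone.inl f).v k (k - 1) (by lia)).hom (p i) -
      ((mappingCone.inr f).f (k - 1)).hom (z i))
    (fun j => ((mappingCone.inr f).f k).hom (y j) -
      ((mappingCone.inl f).v (k + 1) k (by lia)).hom (b j)) fun i => by
      rw [map_sub, cone_d_inl _ _ (k + 1) hprev rfl, cone_d_inr, hy, hp]
      simp only [map_add, map_sum, map_smul, smul_sub, Finset.sum_sub_distrib]
      abel
  obtain ⟨k', rfl⟩ : ∃ l, l = k - 2 := ⟨_, rfl⟩
  refine ⟨fun j => ((mappingCone.fst f).1.v (k - 1) k hprev).hom (c j),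
    fun i => -((mappingCone.fst f).1.v (k - 2) (k - 1) (by lia)).hom (c' i), fun i => ?_⟩
  have := congrArg ((mappingCone.fst f).1.v (k - 1) k hprev).hom (hc i)
  rw [map_sub, cone_fst_inl, cone_fst_inr, sub_zero, map_add, map_sum,
    cone_fst_d (k - 2) (k - 1) k (by lia)] at this
  simpa using this

end MappingCone

end Complexes

open CochainComplex CochainComplex.HomComplex

/-! ### Pure projective modules -/

section PureProjective

variable {R : Type w} [Ring R]

lemma IsPureProjective.exists_lift {M B C : ModuleCat.{v} R} (hM : IsPureProjective M)
    {g : B ⟶ C} (hg : LiftsSystems g.hom) (φ : M ⟶ C) : ∃ ψ : M ⟶ B, ψ ≫ g = φ := by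
  obtain ⟨A, f, h, hS⟩ := isPureEpi_iff.2 hg
  exact hM _ hS φ

lemma IsPureProjective.of_isZero {M : ModuleCat.{v} R} (hM : IsZero M) : IsPureProjective M :=
  fun _ _ _ => ⟨0, hM.eq_of_src _ _⟩

lemma IsPureProjective.of_retract {M N : ModuleCat.{v} R} (hN : IsPureProjective N)
    (i : M ⟶ N) (r : N ⟶ M) (h : i ≫ r = 𝟙 M) : IsPureProjective M := fun S hS g => by
  obtain ⟨ψ, hψ⟩ := hN S hS (r ≫ g)
  exact ⟨i ≫ ψ, by rw [Category.assoc, hψ, reassoc_of% h]⟩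

lemma IsPureProjective.of_iso {M N : ModuleCat.{v} R} (hN : IsPureProjective N) (e : M ≅ N) :
    IsPureProjective M :=
  hN.of_retract e.hom e.inv e.hom_inv_id

lemma isPureProjective_sigma {I : Type v} {F : I → ModuleCat.{v} R}
    (hF : ∀ i, IsPureProjective (F i)) : IsPureProjective (∐ F) := fun S hS g => by
  choose ψ hψ using fun i => hF i S hS (Sigma.ι F i ≫ g)
  exact ⟨Sigma.desc ψ, by ext i : 1; simp [hψ]⟩

/-- A map from a pure projective module to the cocycles of a complex which is exact for maps
from finitely presented modules factors through the differential. -/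
lemma IsPureProjective.exists_comp_d_eq {M : ModuleCat.{v} R} (hM : IsPureProjective M)
    {E : CochainComplex (ModuleCat.{v} R) ℤ} {i k l : ℤ} (hE : HomExactAt E k) (hi : i + 1 = k)
    (hl : k + 1 = l) (φ : M ⟶ E.X k) (hφ : φ ≫ E.d k l = 0) :
    ∃ ψ : M ⟶ E.X i, ψ ≫ E.d i k = φ := by
  let Z := LinearMap.ker (E.d k l).hom
  let g : E.X i ⟶ ModuleCat.of R Z :=
    ModuleCat.ofHom ((E.d i k).hom.codRestrict Z fun x => d_d_apply E i k l x)
  have hg : LiftsSystems g.hom := fun m n a c hc => by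
    obtain ⟨y, hy, hy'⟩ := hE.exists_lift hi hl a (fun j => (c j).1)
      (fun i => by simpa using congrArg Subtype.val (hc i)) fun j => (c j).2
    exact ⟨y, hy, fun j => Subtype.ext (hy' j)⟩
  obtain ⟨ψ, hψ⟩ := hM.exists_lift hg
    (ModuleCat.ofHom (φ.hom.codRestrict Z fun x => by
      exact congrArg (fun t => ModuleCat.Hom.hom t x) hφ))
  refine ⟨ψ, ?_⟩
  ext x
  exact congrArg Subtype.val (congrArg (fun t => ModuleCat.Hom.hom t x) hψ)

end PureProjective

/-! ### Complexes orthogonal to pure exact complexes -/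

section LeftOrthogonal

variable {R : Type w} [Ring R]

/-- A bounded above complex of pure projective modules has only null-homotopic maps to pure
exact complexes. -/
lemma nonempty_homotopy_zero_of_bounded {P E : CochainComplex (ModuleCat.{v} R) ℤ} (N : ℤ)
    (hN : ∀ i, N ≤ i → IsZero (P.X i)) (hP : ∀ i, IsPureProjective (P.X i))
    (hE : ∀ k, HomExactAt E k) (f : P ⟶ E) : Nonempty (Homotopy f 0) := by
  have hδ : ∀ (α : Cochain P E (-1)) (j i l : ℤ) (h : j + 1 = i) (h' : i + 1 = l),
      (δ (-1) 0 α).v i i (add_zero i) =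
        α.v i j (by lia) ≫ E.d j i + P.d i l ≫ α.v l i (by lia) :=
    fun α j i l h h' => by
      simp [δ_v (-1) 0 (by lia) α i i (add_zero i) j l (by lia) h']
  -- A stage is a null-homotopy that is correct in degrees at least `N - k`. Passing to the next
  -- stage changes only the component leaving degree `N - k - 1`, so the components stabilise.
  let S (k : ℕ) : Type _ := { α : Cochain P E (-1) //
    ∀ i, N - k ≤ i → (δ (-1) 0 α).v i i (add_zero i) = f.f i }
  have step : ∀ (k : ℕ) (α : S k), ∃ β : S (k + 1), ∀ p q h, N - k ≤ p →
      β.1.v p q h = α.1.v p q h := by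
    rintro k ⟨α, hα⟩
    obtain ⟨i, hi⟩ : ∃ i, i = N - k - 1 := ⟨_, rfl⟩
    obtain ⟨ψ, hψ⟩ := (hP i).exists_comp_d_eq (hE i) (i := i - 1) (by lia) rfl
      (f.f i - (δ (-1) 0 α).v i i (add_zero i)) (by
        have h1 := hα (i + 1) (by lia)
        rw [hδ α i (i + 1) (i + 2) rfl (by lia)] at h1
        rw [hδ α (i - 1) i (i + 1) (by lia) rfl, Preadditive.sub_comp, f.comm, ← h1]
        simp)
    refine ⟨⟨α + Cochain.single ψ (-1), fun j hj => ?_⟩, fun p q h hp => ?_⟩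
    · rw [δ_add, Cochain.add_v, hδ (Cochain.single ψ (-1)) (j - 1) j (j + 1) (by lia) rfl,
        Cochain.single_v_eq_zero ψ _ (j + 1) _ _ (by lia), comp_zero, add_zero]
      by_cases hij : j = i
      · subst hij
        rw [Cochain.single_v, hψ]
        abel
      · rw [Cochain.single_v_eq_zero ψ _ j _ _ hij, zero_comp, add_zero, hα j (by lia)]
    · rw [Cochain.add_v, Cochain.single_v_eq_zero ψ _ p _ _ (by lia), add_zero]
  choose next hnext using step
  obtain ⟨s, hsucc⟩ : ∃ s : ∀ k, S k, ∀ (k : ℕ) p q h, N - (k : ℤ) ≤ p →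
      (s (k + 1)).1.v p q h = (s k).1.v p q h :=
    ⟨fun k => Nat.rec ⟨0, fun i hi => (hN i (by simpa using hi)).eq_of_src _ _⟩
      (fun k α => next k α) k, fun k => hnext k _⟩
  clear hnext next
  have htoNat : ∀ p : ℤ, N - ((N - p).toNat : ℤ) ≤ p := fun p => by
    have := Int.self_le_toNat (N - p)
    linarith
  have hs : ∀ (l k : ℕ) (p q : ℤ) (h : p + -1 = q), N - k ≤ p →
      (s (k + l)).1.v p q h = (s k).1.v p q h := by
    intro l k p q h hp
    induction l with
    | zero => rfl
    | succ l ih => exact (hsucc (k + l) p q h (by push_cast; linarith)).trans ih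
  -- The limit takes each component from the first stage after which it is constant.
  let γ : Cochain P E (-1) := Cochain.mk fun p q h => (s (N - p).toNat).1.v p q h
  have hγ : ∀ (k : ℕ) (p q : ℤ) (h : p + -1 = q), N - k ≤ p → γ.v p q h = (s k).1.v p q h := by
    intro k p q h hp
    obtain ⟨l, rfl⟩ := Nat.exists_eq_add_of_le (Int.toNat_le.2 (show N - p ≤ k by linarith))
    rw [hs _ _ _ _ _ (htoNat p)]
    rfl
  refine ⟨(Cochain.equivHomotopy f 0).symm ⟨γ, ?_⟩⟩
  rw [Cochain.ofHom_zero, add_zero]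
  ext i
  rw [Cochain.ofHom_v, hδ γ (i - 1) i (i + 1) (sub_add_cancel i 1) rfl, hγ (N - i).toNat i _ _ (htoNat i),
    hγ (N - i).toNat (i + 1) _ _ ((htoNat i).trans (lt_add_one i).le),
    ← hδ _ (i - 1) i (i + 1) (sub_add_cancel i 1) rfl]
  exact congrArg (fun t => ModuleCat.Hom.hom t _) ((s (N - i).toNat).2 i (htoNat i)).symm

lemma shift_d_hom_apply (X : CochainComplex (ModuleCat.{v} R) ℤ) (n i j : ℤ)
    (x : (X⟦n⟧).X i) : ((X⟦n⟧).d i j).hom x =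
      (n.negOnePow : ℤ) • (show (X⟦n⟧).X j from (X.d (i + n) (j + n)).hom x) :=
  rfl

lemma homExactAt_shift {X : CochainComplex (ModuleCat.{v} R) ℤ} (n k : ℤ)
    (h : HomExactAt X (k + n)) : HomExactAt (X⟦n⟧) k := by
  intro m r a x hx hd
  have hn : (n.negOnePow : ℤ) * (n.negOnePow : ℤ) = 1 := by
    rw [← Units.val_mul, Int.units_mul_self, Units.val_one]
  obtain ⟨y, hy, hy'⟩ := h.exists_lift (i := k - 1 + n) (l := k + 1 + n) (by lia) (by lia) a x hx
    fun j => by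
      have := congrArg (fun t => (n.negOnePow : ℤ) • t) (hd j)
      beta_reduce at this
      rw [shift_d_hom_apply, smul_smul, hn, one_smul, smul_zero] at this
      exact this
  let y' : Fin r → (X⟦n⟧).X (k - 1) := y
  have hz : ∀ i, ∑ j, a i j • y' j = 0 := hy
  refine ⟨fun j => (n.negOnePow : ℤ) • y' j, fun i => ?_, fun j => ?_⟩
  · simp only [smul_comm (a _ _) (n.negOnePow : ℤ), ← Finset.smul_sum, hz, smul_zero]
  · rw [map_zsmul, shift_d_hom_apply, smul_smul, hn, one_smul]
    exact hy' j

lemma IsPureExact.shift {X : CochainComplex (ModuleCat.{v} R) ℤ} (h : IsPureExact X) (n : ℤ) :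
    IsPureExact (X⟦n⟧) :=
  isPureExact_iff_homExactAt.2 fun k => homExactAt_shift n k (isPureExact_iff_homExactAt.1 h _)

lemma quotient_map_eq_zero_iff {X Y : CochainComplex (ModuleCat.{v} R) ℤ} (f : X ⟶ Y) :
    (HomotopyCategory.quotient _ _).map f = 0 ↔ Nonempty (Homotopy f 0) :=
  HomotopyCategory.quotient_map_eq_zero_iff f

/-- Solutions are carried to `X`, lifted there and carried back; on cocycles the round trip differs
from the identity by the differential of the homotopy, which is subtracted from the lift. -/
lemma IsPureExact.of_homotopyEquiv {X Y : CochainComplex (ModuleCat.{v} R) ℤ}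
    (e : HomotopyEquiv X Y) (h : IsPureExact X) : IsPureExact Y := by
  rw [isPureExact_iff_homExactAt] at h ⊢
  intro k m n a y hy hd
  obtain ⟨x, hx, hx'⟩ := h k m n a (fun j => (e.inv.f k).hom (y j))
    (fun i => by
      have := congrArg (e.inv.f k).hom (hy i)
      simpa using this)
    fun j => by rw [hom_comm_apply, hd, map_zero]
  have hc : ∀ z : Y.X k, (Y.d k (k + 1)).hom z = 0 → (e.hom.f k).hom ((e.inv.f k).hom z) =
      z + (Y.d (k - 1) k).hom ((e.homotopyInvHomId.hom k (k - 1)).hom z) := fun z hz => by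
    have := e.homotopyInvHomId.comm k
    rw [dNext_eq _ (show (ComplexShape.up ℤ).Rel k (k + 1) by simp),
      prevD_eq _ (show (ComplexShape.up ℤ).Rel (k - 1) k by simp)] at this
    have := congrArg (fun t => ModuleCat.Hom.hom t z) this
    simp only [HomologicalComplex.comp_f, ModuleCat.hom_comp, ModuleCat.hom_add,
      LinearMap.add_apply, LinearMap.comp_apply, hz, map_zero, zero_add,
      HomologicalComplex.id_f, ModuleCat.hom_id, LinearMap.id_apply] at this
    rw [this, add_comm]
  refine ⟨fun j => (e.hom.f (k - 1)).hom (x j) -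
    (e.homotopyInvHomId.hom k (k - 1)).hom (y j), fun i => ?_, fun j => ?_⟩
  · have h1 := congrArg (e.hom.f (k - 1)).hom (hx i)
    have h2 := congrArg (e.homotopyInvHomId.hom k (k - 1)).hom (hy i)
    simp only [map_sum, map_smul, map_zero] at h1 h2
    simp [smul_sub, Finset.sum_sub_distrib, h1, h2]
  · rw [map_sub, hom_comm_apply, hx', hc _ (hd j)]
    abel

variable (R) in
instance : (pureExactComplexes.{w, v} R).IsClosedUnderIsomorphisms where
  of_iso {X Y} e h := by
    obtain ⟨X, rfl⟩ := HomotopyCategory.quotient_obj_surjective X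
    obtain ⟨Y, rfl⟩ := HomotopyCategory.quotient_obj_surjective Y
    exact IsPureExact.of_homotopyEquiv (HomotopyCategory.homotopyEquivOfIso e) h

lemma pureExactComplexes_quotient_iff (X : CochainComplex (ModuleCat.{v} R) ℤ) :
    pureExactComplexes R ((HomotopyCategory.quotient _ _).obj X) ↔ IsPureExact X := Iff.rfl

variable (R) in
instance : (pureExactComplexes.{w, v} R).IsStableUnderShift ℤ where
  isStableUnderShiftBy n := ⟨fun X hX => by
    obtain ⟨X, rfl⟩ := HomotopyCategory.quotient_obj_surjective X
    exact (pureExactComplexes R).prop_of_iso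
      (((HomotopyCategory.quotient _ (.up ℤ)).commShiftIso n).app X)
      ((pureExactComplexes_quotient_iff _).2 (IsPureExact.shift hX n))⟩

variable (R) in
/-- The complexes without nonzero maps to pure exact complexes in the homotopy category. -/
abbrev pureKProjective :
    ObjectProperty (HomotopyCategory (ModuleCat.{v} R) (ComplexShape.up ℤ)) :=
  (pureExactComplexes.{w, v} R).leftOrthogonal

lemma pureKProjective_iff {P : CochainComplex (ModuleCat.{v} R) ℤ} :
    pureKProjective R ((HomotopyCategory.quotient _ _).obj P) ↔
      ∀ (E : CochainComplex (ModuleCat.{v} R) ℤ) (_ : IsPureExact E) (f : P ⟶ E),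
        Nonempty (Homotopy f 0) := by
  refine ⟨fun h E hE f => (quotient_map_eq_zero_iff f).1 (h _ hE), fun h E f hE => ?_⟩
  obtain ⟨E, rfl⟩ := HomotopyCategory.quotient_obj_surjective E
  obtain ⟨f, rfl⟩ := (HomotopyCategory.quotient _ _).map_surjective f
  exact (quotient_map_eq_zero_iff f).2 (h E hE f)

lemma pureKProjective_of_bounded {P : CochainComplex (ModuleCat.{v} R) ℤ} (N : ℤ)
    (hN : ∀ i, N ≤ i → IsZero (P.X i)) (hP : ∀ i, IsPureProjective (P.X i)) :
    pureKProjective R ((HomotopyCategory.quotient _ _).obj P) :=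
  pureKProjective_iff.2 fun _ hE f =>
    nonempty_homotopy_zero_of_bounded N hN hP (isPureExact_iff_homExactAt.1 hE) f

lemma forall_mem_coboundaries_iff {P Y : CochainComplex (ModuleCat.{v} R) ℤ} {n : ℤ} :
    (∀ z : Cocycle P Y n, z ∈ coboundaries P Y n) ↔
      ∀ g : (HomotopyCategory.quotient _ (.up ℤ)).obj P ⟶
        (HomotopyCategory.quotient _ (.up ℤ)).obj (Y⟦n⟧), g = 0 := by
  constructor
  · intro h g
    obtain ⟨c, rfl⟩ := (CohomologyClass.toHom_bijective P Y n).2 g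
    obtain ⟨z, rfl⟩ := c.mk_surjective
    exact (CohomologyClass.toHom_mk_eq_zero_iff z).2 (h z)
  · intro h z
    exact (CohomologyClass.toHom_mk_eq_zero_iff z).1 (h _)

/-- Shifts of pure exact complexes are pure exact, so vanishing in degree `0` gives vanishing in all
degrees. -/
lemma pureKProjective_iff_mem_coboundaries {P : CochainComplex (ModuleCat.{v} R) ℤ} :
    pureKProjective R ((HomotopyCategory.quotient _ _).obj P) ↔
      ∀ (E : CochainComplex (ModuleCat.{v} R) ℤ) (_ : IsPureExact E) (n : ℤ) (z : Cocycle P E n),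
        z ∈ coboundaries P E n := by
  constructor
  · intro h E hE n
    exact forall_mem_coboundaries_iff.2 fun g => h g (hE.shift n)
  · intro h
    refine pureKProjective_iff.2 fun E hE f => ?_
    obtain ⟨β, hβ⟩ := (mem_coboundaries_iff (Cocycle.ofHom f) (-1) (by lia)).1 (h E hE 0 _)
    exact ⟨(Cochain.equivHomotopy f 0).symm ⟨β, by simpa using hβ.symm⟩⟩

end LeftOrthogonal

/-! ### Orthogonality and pure exactness of Hom complexes -/

section PreservesPureExactness

variable {R : Type w} [Ring R]

lemma homComplex_homExactAt_iff {P E : CochainComplex (ModuleCat.{v} R) ℤ} {k : ℤ} :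
    HomExactAt (homComplex P E) k ↔
      ∀ (m n : ℕ) (a : Fin m → Fin n → ℤ) (x : Fin n → Cochain P E k),
        (∀ i, ∑ j, a i j • x j = 0) → (∀ j, δ k (k + 1) (x j) = 0) →
          ∃ y : Fin n → Cochain P E (k - 1), (∀ i, ∑ j, a i j • y j = 0) ∧
            ∀ j, δ (k - 1) k (y j) = x j :=
  Iff.rfl

/-- The complex of `n`-tuples of elements of `E` which solve the homogeneous linear system with
integral matrix `a`. -/
def solutionComplex (E : CochainComplex (ModuleCat.{v} R) ℤ) {m n : ℕ} (a : Fin m → Fin n → ℤ) :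
    CochainComplex (ModuleCat.{v} R) ℤ where
  X k := ModuleCat.of R
    (⨅ i, LinearMap.ker (∑ j, a i j • (LinearMap.proj j : (Fin n → E.X k) →ₗ[R] E.X k)) :
      Submodule R (Fin n → E.X k))
  d k l := ModuleCat.ofHom <| LinearMap.restrict
    (LinearMap.pi fun j => (E.d k l).hom ∘ₗ LinearMap.proj j) fun x hx => by
      simp only [Submodule.mem_iInf, LinearMap.mem_ker, LinearMap.sum_apply,
        LinearMap.smul_apply, LinearMap.proj_apply] at hx ⊢
      intro i
      have := congrArg (E.d k l).hom (hx i)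
      simpa using this
  shape k l h := by
    refine ModuleCat.hom_ext (LinearMap.ext fun x => Subtype.ext (funext fun j => ?_))
    change (E.d k l).hom _ = 0
    rw [E.shape k l h]
    rfl
  d_comp_d' i j k _ _ := by
    refine ModuleCat.hom_ext (LinearMap.ext fun x => Subtype.ext (funext fun s => ?_))
    exact d_d_apply E i j k _

variable {E : CochainComplex (ModuleCat.{v} R) ℤ} {m n : ℕ} {a : Fin m → Fin n → ℤ}

lemma solutionComplex_ext {k : ℤ} {x y : (solutionComplex E a).X k}
    (h : ∀ j, x.1 j = y.1 j) : x = y :=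
  Subtype.ext (funext h)

lemma solutionComplex_sum_eq_zero {k : ℤ} (x : (solutionComplex E a).X k) (i : Fin m) :
    ∑ j, a i j • x.1 j = 0 := by
  have := x.2
  simp only [Submodule.mem_iInf, LinearMap.mem_ker, LinearMap.sum_apply,
    LinearMap.smul_apply, LinearMap.proj_apply] at this
  exact this i

/-- The projections of the complex of solutions. -/
def solutionComplexProj (E : CochainComplex (ModuleCat.{v} R) ℤ) {m n : ℕ}
    (a : Fin m → Fin n → ℤ) (j : Fin n) : solutionComplex E a ⟶ E where
  f _ := ModuleCat.ofHom (LinearMap.proj j ∘ₗ Submodule.subtype _)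
  comm' _ _ _ := rfl

/-- The map to the complex of solutions given by its components. -/
def solutionLift {M : ModuleCat.{v} R} {k : ℤ} (φ : Fin n → (M ⟶ E.X k))
    (h : ∀ i, ∑ j, a i j • φ j = 0) : M ⟶ (solutionComplex E a).X k :=
  ModuleCat.ofHom <| LinearMap.codRestrict _ (LinearMap.pi fun j => (φ j).hom) fun x => by
    simp only [Submodule.mem_iInf, LinearMap.mem_ker, LinearMap.sum_apply,
      LinearMap.smul_apply, LinearMap.proj_apply]
    intro i
    have := congrArg (fun t => ModuleCat.Hom.hom t x) (h i)
    simpa using this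

lemma HomExactAt.of_fintype {k : ℤ} (h : HomExactAt E k) {ι κ : Type*} [Fintype ι] [Fintype κ]
    (a : ι → κ → R) (x : κ → E.X k) (hx : ∀ i, ∑ j, a i j • x j = 0)
    (hd : ∀ j, (E.d k (k + 1)).hom (x j) = 0) :
    ∃ y : κ → E.X (k - 1), (∀ i, ∑ j, a i j • y j = 0) ∧
      ∀ j, (E.d (k - 1) k).hom (y j) = x j := by
  let e := Fintype.equivFin ι
  let e' := Fintype.equivFin κ
  obtain ⟨b, hb, hb'⟩ := h _ _ (fun i j => a (e.symm i) (e'.symm j)) (fun j => x (e'.symm j))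
    (fun i => (e'.symm.sum_comp fun j => a (e.symm i) j • x j).trans (hx _)) fun j => hd _
  refine ⟨fun j => b (e' j), fun i => ?_, fun j => by simp [hb']⟩
  rw [← hb (e i), ← e'.sum_comp]
  simp

/-- A system over `R` whose unknowns are themselves solutions of the integral system `a` is one
larger system in `E`, with both kinds of equations stacked in `c`. -/
lemma IsPureExact.solutionComplex (hE : IsPureExact E) (a : Fin m → Fin n → ℤ) :
    IsPureExact (solutionComplex E a) := by
  rw [isPureExact_iff_homExactAt] at hE ⊢
  intro k p q b x hx hd
  let c : (Fin p × Fin n) ⊕ (Fin m × Fin q) → Fin q × Fin n → R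
    | .inl i, j => if i.2 = j.2 then b i.1 j.1 else 0
    | .inr i, j => if i.2 = j.1 then (a i.1 j.2 : R) else 0
  have hinl : ∀ {l : ℤ} (z : Fin q × Fin n → E.X l) i s,
      ∑ j, c (.inl (i, s)) j • z j = ∑ j, b i j • z (j, s) := fun z i s => by
    simp [c, Fintype.sum_prod_type, ite_smul]
  have hinr : ∀ {l : ℤ} (z : Fin q × Fin n → E.X l) i s,
      ∑ j, c (.inr (i, s)) j • z j = ∑ t, a i t • z (s, t) := fun z i s => by
    simp [c, Fintype.sum_prod_type_right, ite_smul, Int.cast_smul_eq_zsmul]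
  have hcoe : ∀ {l : ℤ} (z : Fin q → (PureDerived.solutionComplex E a).X l) i s,
      (∑ j, b i j • z j).1 s = ∑ j, b i j • (z j).1 s := fun {l} z i s => by
    have := map_sum ((solutionComplexProj E a s).f l).hom (fun j => b i j • z j) Finset.univ
    simp only [map_smul] at this
    exact this
  obtain ⟨y, hy, hy'⟩ := (hE k).of_fintype c (fun j => (x j.1).1 j.2)
    (by
      rintro (⟨i, s⟩ | ⟨i, s⟩)
      · rw [hinl (fun j => (x j.1).1 j.2)]
        exact (hcoe x i s).symm.trans 
          (congrArg (fun z : (PureDerived.solutionComplex E a).X k => z.1 s) (hx i))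
      · rw [hinr (fun j => (x j.1).1 j.2)]
        exact solutionComplex_sum_eq_zero (x s) i)
    fun j => congrFun (congrArg Subtype.val (hd j.1)) j.2
  have hmem : ∀ j, ∀ i, ∑ t, a i t • y (j, t) = 0 := fun j i =>
    (hinr y i j).symm.trans (hy (.inr (i, j)))
  let y' : Fin q → (PureDerived.solutionComplex E a).X (k - 1) := fun j =>
    ⟨fun t => y (j, t), by
      simp only [Submodule.mem_iInf, LinearMap.mem_ker, LinearMap.sum_apply,
        LinearMap.smul_apply, LinearMap.proj_apply]
      exact hmem j⟩
  exact ⟨y', fun i => solutionComplex_ext fun s =>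
    (hcoe y' i s).trans ((hinl y i s).symm.trans (hy (.inl (i, s)))),
    fun j => solutionComplex_ext fun s => hy' (j, s)⟩

/-- The components of a sum of cochains. -/
lemma cochain_sum_smul_v {P Q : CochainComplex (ModuleCat.{v} R) ℤ} {k : ℤ} (b : Fin n → ℤ)
    (x : Fin n → Cochain P Q k) (p q : ℤ) (h : p + k = q) :
    (∑ j, b j • x j).v p q h = ∑ j, b j • (x j).v p q h := by
  let φ : Cochain P Q k →+ (P.X p ⟶ Q.X q) :=
    AddMonoidHom.mk' (fun z => z.v p q h) fun _ _ => rfl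
  have := map_sum φ (fun j => b j • x j) Finset.univ
  simp only [map_zsmul] at this
  exact this

/-- Over `ℤ` only integral systems need lifting. A tuple of cochains solving one is a single cochain
into `solutionComplex E a`, which is again pure exact, so orthogonality bounds it and the components
of the bounding cochain form the lift. -/
lemma isPureExact_homComplex_of_pureKProjective {P : CochainComplex (ModuleCat.{v} R) ℤ}
    (hP : pureKProjective R ((HomotopyCategory.quotient _ _).obj P)) (hE : IsPureExact E) :
    IsPureExact (homComplex P E) := by
  refine isPureExact_iff_homExactAt.2 fun k => homComplex_homExactAt_iff.2 ?_
  intro m n a x hx hd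
  let z : Cochain P (solutionComplex E a) k := Cochain.mk fun p q h =>
    solutionLift (fun j => (x j).v p q h) fun i => by
      rw [← cochain_sum_smul_v, hx, Cochain.zero_v]
  have hz : ∀ j, z.comp (Cochain.ofHom (solutionComplexProj E a j)) (add_zero k) = x j :=
    fun j => by
      ext p q h
      rw [Cochain.comp_zero_cochain_v, Cochain.ofHom_v]
      rfl
  have hδz : δ k (k + 1) z = 0 := by
    ext p q h t
    refine solutionComplex_ext fun j => ?_
    have := δ_comp_ofHom z (solutionComplexProj E a j) (k + 1)
    rw [hz, hd] at this
    have := Cochain.congr_v this.symm p q h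
    rw [Cochain.comp_zero_cochain_v, Cochain.ofHom_v] at this
    exact congrArg (fun s => ModuleCat.Hom.hom s t) this
  obtain ⟨w, hw⟩ := (mem_coboundaries_iff (Cocycle.mk z (k + 1) rfl hδz) (k - 1) (by lia)).1
    (pureKProjective_iff_mem_coboundaries.1 hP _ (hE.solutionComplex a) k _)
  refine ⟨fun j => w.comp (Cochain.ofHom (solutionComplexProj E a j)) (add_zero _),
    fun i => ?_, fun j => ?_⟩
  · ext p q h t
    rw [cochain_sum_smul_v]
    simp only [Cochain.comp_zero_cochain_v, Cochain.ofHom_v]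
    have := solutionComplex_sum_eq_zero ((w.v p q h).hom t) i
    simp only [ModuleCat.hom_sum, ModuleCat.hom_zsmul, LinearMap.sum_apply, LinearMap.smul_apply]
    exact this
  · rw [δ_comp_ofHom, hw]
    exact hz j

lemma PureProjRes.pureKProjective {X : CochainComplex (ModuleCat.{v} R) ℤ} (ρ : PureProjRes X) :
    pureKProjective R ((HomotopyCategory.quotient _ _).obj ρ.P) := by
  refine pureKProjective_iff_mem_coboundaries.2 fun E hE n z => ?_
  obtain ⟨y, hy⟩ := (isPureExact_iff_homExactAt.1 (ρ.preserves E hE) n).exists_d_eq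
    (i := n - 1) (by lia) rfl z.1 (z.δ_eq_zero (n + 1))
  exact (mem_coboundaries_iff z (n - 1) (by lia)).2 ⟨y, hy⟩

lemma isZero_homology_homComplex_iff {P Y : CochainComplex (ModuleCat.{v} R) ℤ} {n : ℤ} :
    IsZero ((homComplex P Y).homology n) ↔ ∀ z : Cocycle P Y n, z ∈ coboundaries P Y n := by
  rw [← HomologicalComplex.exactAt_iff_isZero_homology,
    HomologicalComplex.exactAt_iff' _ (n - 1) n (n + 1) (by simp) (by simp),
    ShortComplex.moduleCat_exact_iff]
  constructor
  · intro h z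
    obtain ⟨y, hy⟩ := h z.1 (z.δ_eq_zero (n + 1))
    exact (mem_coboundaries_iff z (n - 1) (by lia)).2 ⟨y, hy⟩
  · intro h x hx
    exact (mem_coboundaries_iff (Cocycle.mk x (n + 1) rfl hx) (n - 1) (by lia)).1 (h _)

end PreservesPureExactness

/-! ### Enough pure projectives -/

section PureCover

variable {R : Type u} [Ring R]

/-- The module with generators indexed by `Fin n` and relations the rows of `a`. -/
def presentedModule {m n : ℕ} (a : Fin m → Fin n → R) : ModuleCat.{u} R :=
  ModuleCat.of R ((Fin n → R) ⧸ Submodule.span R (Set.range a))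

/-- The generators of a presented module. -/
def presentedModule.gen {m n : ℕ} (a : Fin m → Fin n → R) (j : Fin n) : presentedModule a :=
  (Submodule.span R (Set.range a)).mkQ (Pi.single j 1)

/-- The map out of a presented module given by a solution of the corresponding linear system. -/
def presentedModule.desc {m n : ℕ} {a : Fin m → Fin n → R} {N : ModuleCat.{u} R} (x : Fin n → N)
    (h : ∀ i, ∑ j, a i j • x j = 0) : presentedModule a ⟶ N :=
  ModuleCat.ofHom <| Submodule.liftQ _ (Fintype.linearCombination R x) <| by
    rw [Submodule.span_le]
    rintro _ ⟨i, rfl⟩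
    exact h i

section

variable {m n : ℕ} {a : Fin m → Fin n → R} {N : ModuleCat.{u} R}

lemma presentedModule.desc_gen (x : Fin n → N) (h : ∀ i, ∑ j, a i j • x j = 0) (j : Fin n) :
    (desc x h).hom (gen a j) = x j := by
  change Fintype.linearCombination R x (Pi.single j 1) = _
  simp [Fintype.linearCombination_apply, Pi.single_apply]

lemma presentedModule.hom_ext {f g : presentedModule a ⟶ N}
    (h : ∀ j, f.hom (gen a j) = g.hom (gen a j)) : f = g := by
  refine ModuleCat.hom_ext (Submodule.linearMap_qext _ (LinearMap.pi_ext' fun j => ?_))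
  exact LinearMap.ext_ring (h j)

lemma presentedModule.sum_smul_gen (i : Fin m) : ∑ j, a i j • gen a j = 0 := by
  have h := map_sum (Submodule.span R (Set.range a)).mkQ
    (fun j => a i j • (Pi.single j 1 : Fin n → R)) Finset.univ
  have ha : ∑ j, a i j • (Pi.single j 1 : Fin n → R) = a i := by
    ext k
    simp [Finset.sum_apply, Pi.single_apply]
  simp only [map_smul, ha] at h
  refine h.symm.trans ?_
  exact (Submodule.Quotient.mk_eq_zero _).2 (Submodule.subset_span ⟨i, rfl⟩)

lemma presentedModule.sum_smul_apply_gen (f : presentedModule a ⟶ N) (i : Fin m) :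
    ∑ j, a i j • f.hom (gen a j) = 0 := by
  simp only [← map_smul, ← map_sum, sum_smul_gen, map_zero]

lemma isPureProjective_presentedModule (a : Fin m → Fin n → R) :
    IsPureProjective (presentedModule a) := fun S hS g => by
  obtain ⟨b, hb, hb'⟩ := (isPureShortExact_iff_liftsSystems.1 hS).2 m n a
    (fun j => g.hom (presentedModule.gen a j)) (presentedModule.sum_smul_apply_gen g)
  refine ⟨presentedModule.desc b hb, presentedModule.hom_ext fun j => ?_⟩
  rw [ModuleCat.hom_comp, LinearMap.comp_apply, presentedModule.desc_gen, hb']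

end

/-- The finite linear systems with a solution in `N`. -/
structure SolvedSystem (N : ModuleCat.{u} R) where
  /-- the number of equations -/
  m : ℕ
  /-- the number of unknowns -/
  n : ℕ
  /-- the coefficients -/
  a : Fin m → Fin n → R
  /-- the solution -/
  x : Fin n → N
  sum_eq_zero : ∀ i, ∑ j, a i j • x j = 0

/-- A pure projective module with a pure epimorphism to `N`. -/
def pureCover (N : ModuleCat.{u} R) : ModuleCat.{u} R :=
  ∐ fun s : SolvedSystem N => presentedModule s.a

/-- The pure epimorphism from a pure projective module. -/
def pureCoverπ (N : ModuleCat.{u} R) : pureCover N ⟶ N :=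
  Sigma.desc fun s => presentedModule.desc s.x s.sum_eq_zero

lemma isPureProjective_pureCover (N : ModuleCat.{u} R) : IsPureProjective (pureCover N) :=
  isPureProjective_sigma fun s => isPureProjective_presentedModule s.a

/-- Every solved system in `N` indexes a summand of the cover, whose generators are a universal
solution mapping to the given one. -/
lemma liftsSystems_pureCoverπ (N : ModuleCat.{u} R) : LiftsSystems (pureCoverπ N).hom := by
  intro m n a x hx
  let s : SolvedSystem N := ⟨m, n, a, x, hx⟩
  let ι : presentedModule a ⟶ pureCover N :=
    Sigma.ι (fun s : SolvedSystem N => presentedModule s.a) s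
  refine ⟨fun j => ι.hom (presentedModule.gen a j), presentedModule.sum_smul_apply_gen ι,
    fun j => ?_⟩
  have : ι ≫ pureCoverπ N = presentedModule.desc x hx := Sigma.ι_desc _ s
  rw [← LinearMap.comp_apply, ← ModuleCat.hom_comp, this, presentedModule.desc_gen]

end PureCover

/-! ### Pure exact complexes as a right orthogonal -/

section Orthogonality

variable {R : Type u} [Ring R]

lemma pureKProjective_single {F : ModuleCat.{u} R} (hF : IsPureProjective F) (k : ℤ) :
    pureKProjective R ((HomotopyCategory.quotient _ _).obj
      ((CochainComplex.singleFunctor (ModuleCat.{u} R) k).obj F)) := by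
  refine pureKProjective_of_bounded (k + 1)
    (fun i hi => HomologicalComplex.isZero_single_obj_X _ _ _ _ (by lia)) fun i => ?_
  by_cases hi : i = k
  · subst hi
    exact hF.of_iso (HomologicalComplex.singleObjXSelf (.up ℤ) i F)
  · exact .of_isZero (HomologicalComplex.isZero_single_obj_X _ _ _ _ hi)

variable (R) in
-- Stalks of finitely presented modules already detect pure exactness: a tuple of cocycles solving
-- `a` is a cocycle on the stalk of `presentedModule a`, and bounding it lifts the solution.
lemma pureExactComplexes_eq_rightOrthogonal :
    pureExactComplexes.{u, u} R = (pureKProjective R).rightOrthogonal := by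
  ext E
  refine ⟨fun hE P f hP => hP f hE, fun h => ?_⟩
  obtain ⟨E, rfl⟩ := HomotopyCategory.quotient_obj_surjective E
  change IsPureExact E
  refine isPureExact_iff_homExactAt.2 fun k m n a x hx hd => ?_
  let φ : presentedModule a ⟶ E.X k := presentedModule.desc x hx
  have hφ : φ ≫ E.d k (k + 1) = 0 := presentedModule.hom_ext fun j =>
    (congrArg (E.d k (k + 1)).hom (presentedModule.desc_gen x hx j)).trans (hd j)
  have hz := forall_mem_coboundaries_iff.2
    (fun g => (pureKProjective R).rightOrthogonal.prop_of_iso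
      (((HomotopyCategory.quotient _ (.up ℤ)).commShiftIso (k : ℤ)).symm.app E)
      ((pureKProjective R).rightOrthogonal.le_shift k _ h) g
        (pureKProjective_single (isPureProjective_presentedModule a) 0))
    (Cocycle.fromSingleMk φ (zero_add k) (k + 1) rfl hφ)
  obtain ⟨ψ, hψ⟩ := (Cocycle.fromSingleMk_mem_coboundaries_iff φ (zero_add k) (k + 1) rfl hφ
    (k - 1) (by lia)).1 hz
  refine ⟨fun j => ψ.hom (presentedModule.gen a j), presentedModule.sum_smul_apply_gen ψ,
    fun j => ?_⟩
  rw [← LinearMap.comp_apply, ← ModuleCat.hom_comp, hψ, presentedModule.desc_gen]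

variable (R) in
instance : (pureExactComplexes.{u, u} R).IsTriangulated := by
  rw [pureExactComplexes_eq_rightOrthogonal]
  infer_instance

lemma isPureQuasiIso_iff_trW {X Y : CochainComplex (ModuleCat.{u} R) ℤ} (f : X ⟶ Y) :
    IsPureQuasiIso f ↔ (pureExactComplexes R).trW ((HomotopyCategory.quotient _ _).map f) := by
  have hT := HomotopyCategory.mappingCone_triangleh_distinguished f
  constructor
  · intro h
    exact ObjectProperty.trW.mk _ hT h
  · rintro ⟨Z, g, h, hT', hZ⟩
    let e := Pretriangulated.isoTriangleOfIso₁₂ _ _ hT' hT (Iso.refl _) (Iso.refl _)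
      ((Category.comp_id _).trans (Category.id_comp _).symm)
    exact (pureExactComplexes R).prop_of_iso (Pretriangulated.Triangle.π₃.mapIso e) hZ

/-- The localization functor to the pure derived category reflects isomorphisms into
morphisms whose cone is pure exact. -/
lemma trW_of_isIso_map {X Y : HomotopyCategory (ModuleCat.{u} R) (ComplexShape.up ℤ)}
    (g : X ⟶ Y) (hg : IsIso ((pureExactComplexes R).trW.Q.map g)) :
    (pureExactComplexes R).trW g := by
  obtain ⟨Z, p, q, hT⟩ := Pretriangulated.distinguished_cocone_triangle g
  refine ⟨Z, p, q, hT, ?_⟩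
  have hZ : IsZero ((pureExactComplexes R).trW.Q.obj Z) :=
    (Pretriangulated.Triangle.isZero₃_iff_isIso₁ _
      ((pureExactComplexes R).trW.Q.map_distinguished _ hT)).2 hg
  -- The cone is zero in the localization, and maps to it from orthogonal objects are the same
  -- before localizing; hence it lies in the right orthogonal.
  rw [pureExactComplexes_eq_rightOrthogonal]
  intro P φ hP
  exact (ObjectProperty.leftOrthogonal.map_bijective_of_isTriangulated hP
    (pureExactComplexes R).trW.Q Z).1 (hZ.eq_of_tgt _ _)

end Orthogonality

/-! ### Construction of a resolution in negative degrees -/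

section Resolution

variable {R : Type u} [Ring R] (B : CochainComplex (ModuleCat.{u} R) ℤ)

/-- One step of the construction of a resolution of `B` in negative degrees: `W` is the module of
those pairs in `P × B^{-(k+1)}` which are cycles in the mapping cone, with its two projections. -/
structure ResolutionStage (k : ℕ) where
  /-- the module constructed in the previous step -/
  P : ModuleCat.{u} R
  /-- the module of cycles -/
  W : ModuleCat.{u} R
  /-- the first projection -/
  p : W ⟶ P
  /-- the second projection -/
  q : W ⟶ B.X (Int.negSucc k)

/-- The cycles of the next step. -/
def ResolutionStage.cycles {B : CochainComplex (ModuleCat.{u} R) ℤ} {k : ℕ}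
    (s : ResolutionStage B k) : Submodule R (pureCover s.W × B.X (Int.negSucc (k + 1))) :=
  LinearMap.ker (s.p.hom ∘ₗ (pureCoverπ s.W).hom ∘ₗ LinearMap.fst R _ _) ⊓
    LinearMap.eqLocus (s.q.hom ∘ₗ (pureCoverπ s.W).hom ∘ₗ LinearMap.fst R _ _)
      ((B.d _ _).hom ∘ₗ LinearMap.snd R _ _)

/-- The inductive construction of a resolution. -/
def resolutionStage : (k : ℕ) → ResolutionStage B k
  -- The resolution has nothing in degree `0`; for `B` vanishing from degree `0` on, all of `B^{-1}`
  -- consists of cycles.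
  | 0 => ⟨ModuleCat.of R PUnit, B.X (Int.negSucc 0), 0, 𝟙 _⟩
  | k + 1 =>
    ⟨pureCover (resolutionStage k).W, ModuleCat.of R (resolutionStage k).cycles,
      ModuleCat.ofHom (LinearMap.fst R _ _ ∘ₗ Submodule.subtype _),
      ModuleCat.ofHom (LinearMap.snd R _ _ ∘ₗ Submodule.subtype _)⟩

/-- The modules of the resolution. -/
def resolutionX : ℤ → ModuleCat.{u} R
  | Int.ofNat _ => ModuleCat.of R PUnit
  | Int.negSucc k => pureCover (resolutionStage B k).W

/-- The inclusion of the cycles into the modules of the resolution. -/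
def resolutionP : (k : ℕ) → ((resolutionStage B k).W ⟶ resolutionX B (Int.negSucc k + 1))
  | 0 => 0
  | k + 1 => (resolutionStage B (k + 1)).p

/-- The differential of the resolution. -/
def resolutionD : (n : ℤ) → (resolutionX B n ⟶ resolutionX B (n + 1))
  | Int.ofNat _ => 0
  | Int.negSucc k => pureCoverπ _ ≫ resolutionP B k

/-- The components of the augmentation of the resolution. -/
def resolutionF : (n : ℤ) → (resolutionX B n ⟶ B.X n)
  | Int.ofNat _ => 0
  | Int.negSucc k => pureCoverπ _ ≫ (resolutionStage B k).q

lemma resolutionP_comp_D (k : ℕ) :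
    resolutionP B k ≫ resolutionD B (Int.negSucc k + 1) = 0 := by
  rcases k with _ | _ | k
  · exact zero_comp
  · refine ModuleCat.hom_ext (LinearMap.ext fun w => ?_)
    rfl
  · refine ModuleCat.hom_ext (LinearMap.ext fun w => ?_)
    exact w.2.1

lemma resolutionD_comp (n : ℤ) : resolutionD B n ≫ resolutionD B (n + 1) = 0 := by
  rcases n with n | k
  · exact zero_comp
  · change (pureCoverπ _ ≫ resolutionP B k) ≫ _ = 0
    rw [Category.assoc, resolutionP_comp_D, comp_zero]

lemma resolutionP_comp_F (hB : ∀ i, 0 ≤ i → IsZero (B.X i)) (k : ℕ) :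
    resolutionP B k ≫ resolutionF B (Int.negSucc k + 1) =
      (resolutionStage B k).q ≫ B.d (Int.negSucc k) (Int.negSucc k + 1) := by
  rcases k with _ | k
  · exact (hB _ (by decide)).eq_of_tgt _ _
  · refine ModuleCat.hom_ext (LinearMap.ext fun w => ?_)
    exact w.2.2

lemma resolutionF_comm (hB : ∀ i, 0 ≤ i → IsZero (B.X i)) (n : ℤ) :
    resolutionF B n ≫ B.d n (n + 1) = resolutionD B n ≫ resolutionF B (n + 1) := by
  rcases n with n | k
  · exact (hB _ (by simp; lia)).eq_of_tgt _ _
  · change (pureCoverπ _ ≫ (resolutionStage B k).q) ≫ _ = (pureCoverπ _ ≫ resolutionP B k) ≫ _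
    rw [Category.assoc, Category.assoc, resolutionP_comp_F B hB]

lemma resolutionStage_ext (k : ℕ) (w : (resolutionStage B k).W)
    (hp : (resolutionP B k).hom w = 0) (hq : (resolutionStage B k).q.hom w = 0) : w = 0 := by
  rcases k with _ | k
  · exact hq
  · exact Subtype.ext (Prod.ext hp hq)

lemma resolutionStage_exists (k : ℕ) (p : resolutionX B (Int.negSucc k + 1))
    (b : B.X (Int.negSucc k)) (hp : (resolutionD B _).hom p = 0)
    (hb : (resolutionF B _).hom p = (B.d (Int.negSucc k) (Int.negSucc k + 1)).hom b) :
    ∃ w, (resolutionP B k).hom w = p ∧ (resolutionStage B k).q.hom w = b := by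
  rcases k with _ | _ | k
  · exact ⟨b, rfl, rfl⟩
  · exact ⟨⟨(p, b), rfl, hb⟩, rfl, rfl⟩
  · exact ⟨⟨(p, b), hp, hb⟩, rfl, rfl⟩

/-- The resolution of a complex concentrated in negative degrees. -/
def resolution : CochainComplex (ModuleCat.{u} R) ℤ :=
  CochainComplex.of (resolutionX B) (resolutionD B) (resolutionD_comp B)

lemma resolution_d (n : ℤ) : (resolution B).d n (n + 1) = resolutionD B n :=
  CochainComplex.of_d ..

/-- The augmentation of the resolution. -/
def resolutionHom (hB : ∀ i, 0 ≤ i → IsZero (B.X i)) : resolution B ⟶ B where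
  f := resolutionF B
  comm' i j h := by
    obtain rfl : i + 1 = j := h
    rw [resolution_d]
    exact resolutionF_comm B hB i

lemma resolution_isPureProjective (i : ℤ) : IsPureProjective ((resolution B).X i) := by
  rcases i with i | k
  · exact .of_isZero (ModuleCat.isZero_of_subsingleton (ModuleCat.of R PUnit))
  · exact isPureProjective_pureCover _

lemma resolution_isZero (i : ℤ) (hi : 0 ≤ i) : IsZero ((resolution B).X i) := by
  rcases i with i | k
  · exact ModuleCat.isZero_of_subsingleton (ModuleCat.of R PUnit)
  · exact absurd hi (by simp)

/-- A tuple of cone cycles solving a system is, up to a sign in the first component, a tuple in the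
module `W` of cycles solving the same system; the pure cover of `W` lifts it. -/
lemma resolution_isPureQuasiIso (hB : ∀ i, 0 ≤ i → IsZero (B.X i)) :
    IsPureQuasiIso (resolutionHom B hB) := by
  refine isPureExact_iff_homExactAt.2 fun i m n a x hx hd => ?_
  let f := resolutionHom B hB
  have hprev : (i - 1) + 1 = i := by lia
  let p : Fin n → (resolution B).X (i + 1) := fun j =>
    ((mappingCone.fst f).1.v i (i + 1) rfl).hom (x j)
  let b : Fin n → B.X i := fun j => ((mappingCone.snd f).v i i (add_zero i)).hom (x j)
  have hp : ∀ s, ∑ j, a s j • p j = 0 := fun s => by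
    simp only [p, ← map_smul, ← map_sum, hx, map_zero]
  have hnp : ∀ s, ∑ j, a s j • (-p j) = 0 := fun s => by
    simp only [smul_neg, Finset.sum_neg_distrib, hp, neg_zero]
  have hb : ∀ s, ∑ j, a s j • b j = 0 := fun s => by
    simp only [b, ← map_smul, ← map_sum, hx, map_zero]
  have hdp : ∀ j, ((resolution B).d (i + 1) (i + 1 + 1)).hom (p j) = 0 := fun j => by
    have := congrArg ((mappingCone.fst f).1.v (i + 1) (i + 1 + 1) rfl).hom (hd j)
    rw [cone_fst_d i (i + 1) _ rfl rfl, map_zero, neg_eq_zero] at this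
    exact this
  have hdb : ∀ j, (f.f (i + 1)).hom (p j) + (B.d i (i + 1)).hom (b j) = 0 := fun j => by
    have := congrArg ((mappingCone.snd f).v (i + 1) (i + 1) (add_zero _)).hom (hd j)
    rwa [cone_snd_d i (i + 1) rfl, map_zero] at this
  have hx' : ∀ j, x j = ((mappingCone.inl f).v (i + 1) i (by lia)).hom (p j) +
      ((mappingCone.inr f).f i).hom (b j) := fun j => by
    have := mappingCone.id_X f i (i + 1) rfl
    exact congrArg (fun t => ModuleCat.Hom.hom t (x j)) this.symm
  obtain ⟨y, hy, hdy, hfy⟩ : ∃ y : Fin n → (resolution B).X i, (∀ s, ∑ j, a s j • y j = 0) ∧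
      (∀ j, ((resolution B).d i (i + 1)).hom (y j) = -p j) ∧
      ∀ j, (f.f i).hom (y j) = b j := by
    rw [resolution_d]
    rcases i with i | k
    · have h0 := resolution_isZero B (Int.ofNat i + 1) (by simp; lia)
      have h1 := hB (Int.ofNat i) (by simp)
      have := ModuleCat.subsingleton_of_isZero h0
      have := ModuleCat.subsingleton_of_isZero h1
      exact ⟨0, by simp, fun j => Subsingleton.elim _ _, fun j => Subsingleton.elim _ _⟩
    · rw [resolution_d] at hdp
      -- The sign comes from the cone differential, which sends `y` to `(-d y, f y)`.
      choose w hw hw' using fun j => resolutionStage_exists B k (-p j) (b j)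
        ((map_neg _ _).trans (neg_eq_zero.2 (hdp j))) ((map_neg _ _).trans
          (neg_eq_of_add_eq_zero_right (hdb j)))
      obtain ⟨y, hy, hyw⟩ := liftsSystems_pureCoverπ (resolutionStage B k).W m n a w fun s =>
        resolutionStage_ext B k _
          (by simp only [map_sum, map_smul, hw]
              exact hnp s)
          (by simp only [map_sum, map_smul, hw', hb])
      refine ⟨y, hy, fun j => ?_, fun j => ?_⟩
      · exact (congrArg (resolutionP B k).hom (hyw j)).trans (hw j)
      · exact (congrArg (resolutionStage B k).q.hom (hyw j)).trans (hw' j)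
  refine ⟨fun j => ((mappingCone.inl f).v i (i - 1) (by lia)).hom (y j), fun s => ?_,
    fun j => ?_⟩
  · simp only [← map_smul, ← map_sum, hy, map_zero]
  · rw [cone_d_inl (i - 1) i (i + 1) hprev rfl, hdy, hfy, hx', map_neg, sub_neg_eq_add, add_comm]

end Resolution

/-! ### Existence of resolutions -/

section Existence

variable {R : Type u} [Ring R]

/-- A complex which is isomorphic in the pure derived category to a bounded complex has a pure
projective resolution. -/
lemma InDbPur.nonempty_pureProjRes {X : CochainComplex (ModuleCat.{u} R) ℤ} (hX : InDbPur X) :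
    Nonempty (PureProjRes X) := by
  obtain ⟨B, ⟨_, N, hB⟩, ⟨e⟩⟩ := hX
  let q := HomotopyCategory.quotient (ModuleCat.{u} R) (.up ℤ)
  let L := (pureExactComplexes.{u, u} R).trW.Q
  have hB' : ∀ i, 0 ≤ i → IsZero ((B⟦N + 1⟧).X i) := fun i hi => hB (i + (N + 1)) (by lia)
  let P := resolution (B⟦N + 1⟧)
  let f : P ⟶ B⟦N + 1⟧ := resolutionHom _ hB'
  have hf := (isPureQuasiIso_iff_trW f).1 (resolution_isPureQuasiIso _ hB')
  have hP : pureKProjective R (q.obj P) :=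
    pureKProjective_of_bounded 0 (resolution_isZero _) (resolution_isPureProjective _)
  have hP' : pureKProjective R (q.obj (P⟦-(N + 1)⟧)) :=
    (pureKProjective R).prop_of_iso ((q.commShiftIso (-(N + 1))).symm.app P)
      ((pureKProjective R).le_shift _ _ hP)
  have hfshift : (pureExactComplexes R).trW ((q.map f)⟦-(N + 1)⟧') := hf.shift _
  have hiso : IsIso (L.map ((q.map f)⟦-(N + 1)⟧')) :=
    Localization.inverts L (pureExactComplexes R).trW _ hfshift
  let e₁ : L.obj (q.obj (P⟦-(N + 1)⟧)) ≅ L.obj (q.obj X) :=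
    L.mapIso ((q.commShiftIso (-(N + 1))).app P) ≪≫ @asIso _ _ _ _ _ hiso ≪≫
      L.mapIso ((q.commShiftIso (-(N + 1))).symm.app (B⟦N + 1⟧)) ≪≫
      L.mapIso (q.mapIso ((shiftEquiv _ (N + 1)).unitIso.symm.app B)) ≪≫ e.symm
  -- The isomorphism in the pure derived category starts at an orthogonal object, so it comes from a
  -- map in the homotopy category.
  obtain ⟨g, hg⟩ := (ObjectProperty.leftOrthogonal.map_bijective_of_isTriangulated hP' L
    (q.obj X)).2 e₁.hom
  obtain ⟨g, rfl⟩ := q.map_surjective g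
  exact ⟨{
    P := P⟦-(N + 1)⟧
    f := g
    isPureQuasiIso := (isPureQuasiIso_iff_trW g).2
      (trW_of_isIso_map _ (by rw [hg]; infer_instance))
    isPureProjective := fun i => resolution_isPureProjective _ (i + -(N + 1))
    preserves := fun E hE => isPureExact_homComplex_of_pureKProjective hP' hE }⟩

end Existence

/-! ### Independence of the resolution -/

section Comparison

variable {R : Type u} [Ring R]

/-- The cohomology of `Hom(P, Y)` vanishes for one pure projective resolution `P` of `X` if and
only if it vanishes for any other. -/
lemma PureProjRes.forall_mem_coboundaries {X Y : CochainComplex (ModuleCat.{u} R) ℤ}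
    (ρ σ : PureProjRes X) (n : ℤ) (h : ∀ z : Cocycle ρ.P Y n, z ∈ coboundaries ρ.P Y n)
    (z : Cocycle σ.P Y n) : z ∈ coboundaries σ.P Y n := by
  rw [forall_mem_coboundaries_iff] at h
  revert z
  rw [forall_mem_coboundaries_iff]
  intro g
  let q := HomotopyCategory.quotient (ModuleCat.{u} R) (.up ℤ)
  have hρ := (isPureQuasiIso_iff_trW ρ.f).1 ρ.isPureQuasiIso
  have hσ := (isPureQuasiIso_iff_trW σ.f).1 σ.isPureQuasiIso
  have hρP := ρ.pureKProjective
  have hσP := σ.pureKProjective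
  rw [PureDerived.pureKProjective, ← ObjectProperty.isColocal_trW] at hρP hσP
  obtain ⟨α, hα⟩ := (hσP _ hρ).2 (q.map σ.f)
  obtain ⟨β, hβ⟩ := (hρP _ hσ).2 (q.map ρ.f)
  -- By uniqueness of lifts along `σ.f`, the complex `σ.P` is a retract of `ρ.P` up to homotopy,
  -- which is enough to transfer vanishing.
  have hαβ : α ≫ β = 𝟙 _ := (hσP _ hσ).1 (by
    beta_reduce at hα hβ ⊢
    rw [Category.assoc, hβ, hα, Category.id_comp])
  rw [← Category.id_comp g, ← hαβ, Category.assoc, h (β ≫ g), comp_zero]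

lemma isZero_pext_iff {X Y : CochainComplex (ModuleCat.{u} R) ℤ} (ρ : PureProjRes X) (n : ℤ) :
    IsZero (Pext n X Y) ↔ ∀ z : Cocycle ρ.P Y n, z ∈ coboundaries ρ.P Y n := by
  have h : Nonempty (PureProjRes X) := ⟨ρ⟩
  rw [Pext, dif_pos h, isZero_homology_homComplex_iff]
  exact ⟨fun h' => h.some.forall_mem_coboundaries ρ n h',
    fun h' => ρ.forall_mem_coboundaries h.some n h'⟩

end Comparison

/-! ### A pure exact truncation -/

section Quotient

variable {R : Type w} [Ring R] (Y : CochainComplex (ModuleCat.{v} R) ℤ)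

/-- The kernel of the projection to the truncation in degrees at least `m - 1`: everything in
degrees less than `m - 1` and the cocycles in degree `m - 1`. -/
def truncKer (m k : ℤ) : Submodule R (Y.X k) :=
  if m ≤ k then ⊥ else if m ≤ k + 1 then LinearMap.ker (Y.d k (k + 1)).hom else ⊤

lemma truncKer_le_comap (m k l : ℤ) :
    truncKer Y m k ≤ (truncKer Y m l).comap (Y.d k l).hom := by
  intro y hy
  rw [Submodule.mem_comap]
  by_cases hkl : k + 1 = l
  · subst hkl
    unfold truncKer at hy ⊢
    split_ifs at hy ⊢ <;> first | lia | skip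
    · rw [(Submodule.mem_bot R).1 hy, map_zero]
      exact zero_mem _
    · exact hy
    · exact d_d_apply ..
    · trivial
  · rw [Y.shape k l hkl]
    exact zero_mem _

/-- The truncation of `Y` in degrees at least `m - 1`, with `Y^{m-1}` replaced by its quotient by
the cocycles. -/
def truncQuotient (m : ℤ) : CochainComplex (ModuleCat.{v} R) ℤ where
  X k := ModuleCat.of R (Y.X k ⧸ truncKer Y m k)
  d k l := ModuleCat.ofHom ((truncKer Y m k).mapQ (truncKer Y m l) (Y.d k l).hom
    (truncKer_le_comap Y m k l))
  shape k l h := by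
    refine ModuleCat.hom_ext (Submodule.linearMap_qext _ (LinearMap.ext fun y => ?_))
    change Submodule.Quotient.mk ((Y.d k l).hom y) = 0
    rw [Y.shape k l h]
    rfl
  d_comp_d' i j k _ _ := by
    refine ModuleCat.hom_ext (Submodule.linearMap_qext _ (LinearMap.ext fun y => ?_))
    change Submodule.Quotient.mk ((Y.d j k).hom ((Y.d i j).hom y)) = 0
    rw [d_d_apply]
    rfl

/-- The projection to the truncation. -/
def truncQuotientπ (m : ℤ) : Y ⟶ truncQuotient Y m where
  f k := ModuleCat.ofHom (truncKer Y m k).mkQ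
  comm' _ _ _ := rfl

variable {Y} {m : ℤ}

lemma truncQuotientπ_eq_zero_iff {k : ℤ} (y : Y.X k) :
    ((truncQuotientπ Y m).f k).hom y = 0 ↔ y ∈ truncKer Y m k :=
  Submodule.Quotient.mk_eq_zero _

lemma truncQuotientπ_surjective (k : ℤ) :
    Function.Surjective ((truncQuotientπ Y m).f k).hom :=
  Submodule.mkQ_surjective _

/-- The only delicate degree is `m - 1`, where the projection is that onto the quotient by cocycles;
there lifting is the Hom condition in degree `m`. -/
lemma truncQuotientπ_liftsSystems (hY : ∀ k, m ≤ k → HomExactAt Y k) (k : ℤ) :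
    LiftsSystems ((truncQuotientπ Y m).f k).hom := by
  intro p q a c hc
  choose b hb using fun j => truncQuotientπ_surjective (Y := Y) (m := m) k (c j)
  have hb' : ∀ i, ∑ j, a i j • b j ∈ truncKer Y m k := fun i => by
    rw [← truncQuotientπ_eq_zero_iff, map_sum, ← hc i]
    exact Finset.sum_congr rfl fun j _ => by rw [map_smul, hb]
  by_cases h₁ : m ≤ k
  · refine ⟨b, fun i => ?_, hb⟩
    have := hb' i
    rwa [truncKer, if_pos h₁, Submodule.mem_bot] at this
  by_cases h₂ : m ≤ k + 1
  · obtain ⟨b', h, hd⟩ := (hY (k + 1) h₂).pureOntoImageAt rfl p q a b fun i => by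
      have := hb' i
      rw [truncKer, if_neg h₁, if_pos h₂, LinearMap.mem_ker] at this
      simpa using this
    refine ⟨b', h, fun j => ?_⟩
    rw [← hb, ← sub_eq_zero, ← map_sub, truncQuotientπ_eq_zero_iff, truncKer, if_neg h₁,
      if_pos h₂, LinearMap.mem_ker, map_sub, hd, sub_self]
  · refine ⟨0, by simp, fun j => ?_⟩
    rw [← hb, ← sub_eq_zero, ← map_sub, truncQuotientπ_eq_zero_iff, truncKer, if_neg h₁,
      if_neg h₂]
    trivial

lemma isPureExact_truncQuotient (hY : ∀ k, m ≤ k → HomExactAt Y k) :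
    IsPureExact (truncQuotient Y m) := by
  refine isPureExact_iff_homExactAt.2 fun k p q a e he hd => ?_
  obtain ⟨y, hy, hye⟩ := truncQuotientπ_liftsSystems hY k p q a e he
  have hdy : ∀ j, (Y.d k (k + 1)).hom (y j) ∈ truncKer Y m (k + 1) := fun j => by
    rw [← truncQuotientπ_eq_zero_iff, ← hom_comm_apply, hye, hd]
  by_cases h₁ : m ≤ k
  · obtain ⟨w, hw, hdw⟩ := hY k h₁ p q a y hy fun j => by
      have := hdy j
      rwa [truncKer, if_pos (by lia), Submodule.mem_bot] at this
    refine ⟨fun j => ((truncQuotientπ Y m).f (k - 1)).hom (w j), fun i => ?_, fun j => ?_⟩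
    · simp only [← map_smul, ← map_sum, hw, map_zero]
    · rw [hom_comm_apply, hdw, hye]
  · refine ⟨0, by simp, fun j => ?_⟩
    rw [Pi.zero_apply, map_zero, eq_comm, ← hye, truncQuotientπ_eq_zero_iff, truncKer, if_neg h₁]
    split_ifs with h₂
    · have := hdy j
      rwa [truncKer, if_pos h₂, Submodule.mem_bot] at this
    · trivial

end Quotient

/-! ### Vanishing of Pext and its consequences -/

section Vanishing

variable {R : Type w} [Ring R]

/-- If `P` vanishes in degrees less than `-n` and `Y` is pure exact in degrees at least `i - n`,
then every cocycle of degree `i` from `P` to `Y` is a coboundary. -/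
lemma mem_coboundaries_of_isZero {P Y : CochainComplex (ModuleCat.{v} R) ℤ} {n i : ℤ}
    (hP : pureKProjective R ((HomotopyCategory.quotient _ _).obj P))
    (hpp : ∀ k, IsPureProjective (P.X k)) (hz : ∀ k, k < -n → IsZero (P.X k))
    (hY : ∀ k, i - n ≤ k → HomExactAt Y k) (z : Cocycle P Y i) : z ∈ coboundaries P Y i := by
  let π := truncQuotientπ Y (i - n)
  obtain ⟨w, hw⟩ := (mem_coboundaries_iff (z.postcomp π) (i - 1) (sub_add_cancel i 1)).1
    (pureKProjective_iff_mem_coboundaries.1 hP _ (isPureExact_truncQuotient hY) i _)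
  -- The bounding cochain is lifted along the pure epimorphisms `π` degree by degree; the lift need
  -- not bound `z` everywhere.
  choose w' hw' using fun (p q : ℤ) (h : p + (i - 1) = q) =>
    (hpp p).exists_lift (truncQuotientπ_liftsSystems hY q) (w.v p q h)
  let β : Cochain P Y (i - 1) := Cochain.mk w'
  have hβ : β.comp (Cochain.ofHom π) (add_zero _) = w := by
    ext p q h : 1
    rw [Cochain.comp_zero_cochain_v, Cochain.ofHom_v]
    exact hw' p q h
  refine (mem_coboundaries_iff z (i - 1) (sub_add_cancel i 1)).2 ⟨β, ?_⟩
  ext p q h t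
  by_cases hp : p < -n
  · have := ModuleCat.subsingleton_of_isZero (hz p hp)
    rw [Subsingleton.elim t 0, map_zero, map_zero]
  -- From source degree `-n` on, the target degree is at least `i - n`, where `π` is injective; so
  -- `δ β = z` can be checked after `π`.
  · have hq : i - n ≤ q := by
      have := not_lt.1 hp
      linarith
    have h1 := δ_comp_ofHom β π i
    rw [hβ, hw] at h1
    have h2 := congrArg (fun s => ModuleCat.Hom.hom s t) (Cochain.congr_v h1 p q h)
    rw [Cochain.comp_zero_cochain_v, Cochain.ofHom_v] at h2
    have h3 : (π.f q).hom ((z.1.v p q h).hom t) =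
        (π.f q).hom (((δ (i - 1) i β).v p q h).hom t) := by
      refine Eq.trans ?_ h2
      change _ = (((z.1.comp (Cochain.ofHom π) (add_zero i)).v p q h).hom t)
      rw [Cochain.comp_zero_cochain_v, Cochain.ofHom_v]
      rfl
    rw [← sub_eq_zero, ← map_sub, truncQuotientπ_eq_zero_iff, truncKer, if_pos hq,
      Submodule.mem_bot, sub_eq_zero] at h3
    exact h3.symm

lemma supP_stalk_le (N : ModuleCat.{v} R) : supP (stalk N) ≤ ((0 : ℤ) : ℝ) := by
  refine supP_le fun k hk => isPureExactAt_iff.2 ?_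
  have : Subsingleton ((stalk N).X k) := ModuleCat.subsingleton_of_isZero
    (HomologicalComplex.isZero_single_obj_X _ _ _ _ (by lia))
  exact ⟨fun _ _ _ _ _ _ => ⟨0, by simp, fun _ => Subsingleton.elim _ _⟩,
    fun _ _ _ _ _ _ => ⟨0, 0, fun _ => Subsingleton.elim _ _⟩,
    fun _ _ _ x _ => ⟨x, fun _ => Subsingleton.elim _ _, fun _ => rfl⟩⟩

/-- If cocycles with values in `Coker d` are coboundaries, then the map induced by the next
differential on `Coker d` is a split monomorphism. -/
lemma exists_d_comp_eq_cokernel_π {P : CochainComplex (ModuleCat.{v} R) ℤ} {i p p' p'' : ℤ}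
    (hp : p + i = 0) (hp' : p' + 1 = p) (hp'' : p + 1 = p'')
    (h : ∀ z : Cocycle P (stalk (cokernel (P.d p' p))) i, z ∈ coboundaries _ _ i) :
    ∃ g : P.X p'' ⟶ cokernel (P.d p' p), P.d p p'' ≫ g = cokernel.π (P.d p' p) :=
  (Cocycle.toSingleMk_mem_coboundaries_iff (cokernel.π (P.d p' p)) hp p' hp'
    (cokernel.condition _) p'' hp'').1 (h _)

lemma cokernel_π_surjective {A B : ModuleCat.{v} R} (d : A ⟶ B) :
    Function.Surjective (cokernel.π d).hom :=
  (ModuleCat.epi_iff_surjective _).1 inferInstance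

/-- Through `g`, the class of `x` in the cokernel is determined by `d x`; representatives of the `g
(b j)` therefore solve for `x` up to boundaries. -/
lemma tensorExactAt_of_d_comp_eq {P : CochainComplex (ModuleCat.{v} R) ℤ} {k : ℤ}
    (g : P.X (k + 1) ⟶ cokernel (P.d (k - 1) k))
    (hg : P.d k (k + 1) ≫ g = cokernel.π (P.d (k - 1) k)) : TensorExactAt P k := by
  intro m n a x b hx
  choose y hy using fun j => cokernel_π_surjective (P.d (k - 1) k) (g.hom (b j))
  choose z hz using fun s => (ker_cokernel_π (P.d (k - 1) k) (x s - ∑ j, a s j • y j)).1 (by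
    have h1 : (cokernel.π (P.d (k - 1) k)).hom (x s) = g.hom ((P.d k (k + 1)).hom (x s)) := by
      rw [← hg]
      rfl
    rw [map_sub, h1, hx]
    simp [hy])
  exact ⟨y, z, fun s => by rw [hz]; abel⟩

/-- The map `g` splits the induced map `δ` from the first cokernel, and the complementary idempotent
`1 - g ≫ δ` kills the image of `d`, making the next cokernel a direct summand of `P.X k`. -/
lemma isPureProjective_cokernel_of_d_comp_eq {P : CochainComplex (ModuleCat.{v} R) ℤ}
    {i j k : ℤ} (hP : IsPureProjective (P.X k)) (g : P.X k ⟶ cokernel (P.d i j))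
    (hg : P.d j k ≫ g = cokernel.π (P.d i j)) : IsPureProjective (cokernel (P.d j k)) := by
  let δ := cokernel.desc (P.d i j) (P.d j k) (P.d_comp_d i j k)
  have hδ : cokernel.π (P.d i j) ≫ δ = P.d j k := cokernel.π_desc ..
  have hδπ : δ ≫ cokernel.π (P.d j k) = 0 := by
    rw [← cancel_epi (cokernel.π (P.d i j)), ← Category.assoc, hδ, cokernel.condition, comp_zero]
  have he : P.d j k ≫ (𝟙 _ - g ≫ δ) = 0 := by
    rw [Preadditive.comp_sub, Category.comp_id, ← Category.assoc, hg, hδ, sub_self]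
  refine hP.of_retract (cokernel.desc (P.d j k) _ he) (cokernel.π _) ?_
  rw [← cancel_epi (cokernel.π (P.d j k)), cokernel.π_desc_assoc, Preadditive.sub_comp,
    Category.assoc, hδπ, comp_zero, sub_zero, Category.id_comp, Category.comp_id]

end Vanishing

/-! ### Splitting off a contractible summand -/

section Splitting

variable {R : Type w} [Ring R]

lemma exists_biprod_iso_of_idempotent {P : CochainComplex (ModuleCat.{v} R) ℤ} (r : P ⟶ P)
    (hr : r ≫ r = r) : ∃ (P₁ P₂ : CochainComplex (ModuleCat.{v} R) ℤ) (ι₁ : P₁ ⟶ P)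
      (ι₂ : P₂ ⟶ P) (t₂ : P ⟶ P₂), Nonempty (P ≅ P₁ ⊞ P₂) ∧ Mono ι₁ ∧ ι₁ ≫ r = 0 ∧
        ι₂ ≫ t₂ = 𝟙 _ ∧ t₂ ≫ ι₂ = r := by
  let s : P ⟶ P := 𝟙 P - r
  have hsr : s ≫ r = 0 := by simp [s, hr]
  have hrs : r ≫ s = 0 := by simp [s, hr]
  let t₁ : P ⟶ kernel r := kernel.lift r s hsr
  let t₂ : P ⟶ kernel s := kernel.lift s r hrs
  have h₁ : t₁ ≫ kernel.ι r = s := kernel.lift_ι ..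
  have h₂ : t₂ ≫ kernel.ι s = r := kernel.lift_ι ..
  have h₁₁ : kernel.ι r ≫ t₁ = 𝟙 _ := by
    rw [← cancel_mono (kernel.ι r), Category.assoc, h₁]
    simp [s]
  have hι : kernel.ι s ≫ r = kernel.ι s := by
    have := kernel.condition s
    rw [Preadditive.comp_sub, Category.comp_id, sub_eq_zero] at this
    exact this.symm
  have h₂₂ : kernel.ι s ≫ t₂ = 𝟙 _ := by
    rw [← cancel_mono (kernel.ι s), Category.assoc, h₂, hι, Category.id_comp]
  have h₁₂ : kernel.ι r ≫ t₂ = 0 := by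
    rw [← cancel_mono (kernel.ι s), Category.assoc, h₂, kernel.condition, zero_comp]
  have h₂₁ : kernel.ι s ≫ t₁ = 0 := by
    rw [← cancel_mono (kernel.ι r), Category.assoc, h₁, kernel.condition, zero_comp]
  refine ⟨kernel r, kernel s, kernel.ι r, kernel.ι s, t₂, ⟨?_⟩, inferInstance,
    kernel.condition r, h₂₂, h₂⟩
  exact
    { hom := biprod.lift t₁ t₂
      inv := biprod.desc (kernel.ι r) (kernel.ι s)
      hom_inv_id := by rw [biprod.lift_desc, h₁, h₂]; simp [s]
      inv_hom_id := by
        apply biprod.hom_ext' <;> apply biprod.hom_ext <;> simp [h₁₁, h₁₂, h₂₁, h₂₂] }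

lemma isContractible_of_isPureExact {P : CochainComplex (ModuleCat.{v} R) ℤ}
    (hP : pureKProjective R ((HomotopyCategory.quotient _ _).obj P)) (h : IsPureExact P) :
    IsContractible P :=
  pureKProjective_iff.1 hP P h (𝟙 P)

lemma TensorExactAt.of_retract {P Q : CochainComplex (ModuleCat.{v} R) ℤ} {k : ℤ}
    (h : TensorExactAt P k) (ι : Q ⟶ P) (t : P ⟶ Q) (hιt : ι ≫ t = 𝟙 Q) : TensorExactAt Q k := by
  have hret : ∀ l (x : Q.X l), (t.f l).hom ((ι.f l).hom x) = x := fun l x =>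
    congrArg (fun s => ModuleCat.Hom.hom (HomologicalComplex.Hom.f s l) x) hιt
  intro m n a x b hx
  obtain ⟨y, z, hy⟩ := h m n a (fun i => (ι.f k).hom (x i)) (fun j => (ι.f (k + 1)).hom (b j))
    fun i => by simp [hom_comm_apply, hx]
  refine ⟨fun j => (t.f k).hom (y j), fun i => (t.f (k - 1)).hom (z i), fun i => ?_⟩
  rw [← hret k (x i), hy, hom_comm_apply]
  simp

/-- A complex of pure projective modules `P` which is exact for tensor products in degrees less
than `N` and such that `Coker d^{N-1}` is pure projective is the direct sum of a complex vanishing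
in degrees less than `N` and a contractible one, if it is orthogonal to pure exact complexes. -/
lemma exists_biprod_iso_of_isPureProjective_cokernel {P : CochainComplex (ModuleCat.{v} R) ℤ}
    (hP : pureKProjective R ((HomotopyCategory.quotient _ _).obj P)) (N : ℤ)
    (hT : ∀ k < N, TensorExactAt P k) (hC : IsPureProjective (cokernel (P.d (N - 1) N))) :
    ∃ P₁ P₂ : CochainComplex (ModuleCat.{v} R) ℤ, Nonempty (P ≅ P₁ ⊞ P₂) ∧
      (∀ i, i < N → IsZero (P₁.X i)) ∧ IsContractible P₂ := by
  have hN : (N - 1) + 1 = N := by lia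
  -- Tensor exactness in degree `N - 1` says that the projection onto the cokernel is a pure
  -- epimorphism, so it splits when the cokernel is pure projective.
  have hπ : LiftsSystems (cokernel.π (P.d (N - 1) N)).hom := by
    intro m n a c hc
    choose b hb using fun j => cokernel_π_surjective (P.d (N - 1) N) (c j)
    choose x hx using fun i => (ker_cokernel_π (P.d (N - 1) N) (∑ j, a i j • b j)).1
      (by simp [hb, hc])
    obtain ⟨y, z, hy⟩ := (hT (N - 1) (by lia)).exists_eq (i := N - 2) (by lia) hN a x b hx
    refine ⟨fun j => b j - (P.d (N - 1) N).hom (y j), fun i => ?_, fun j => ?_⟩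
    · simp [smul_sub, Finset.sum_sub_distrib, ← hx, hy, d_d_apply]
    · rw [map_sub, hb, (ker_cokernel_π (P.d (N - 1) N) _).2 ⟨y j, rfl⟩, sub_zero]
  obtain ⟨σ, hσ⟩ := hC.exists_lift hπ (𝟙 _)
  -- Components of the idempotent: the identity below `N`, zero above `N`, and in degree `N` the
  -- projection onto the image of `d^{N-1}` along the section `σ`.
  have hr : ∀ i, ∃ e : P.X i ⟶ P.X i, (i < N → e = 𝟙 _) ∧ (N < i → e = 0) ∧
      (i ≤ N → P.d (i - 1) i ≫ e = P.d (i - 1) i) ∧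
      (N ≤ i → ∀ y, ∃ v, (P.d (i - 1) i).hom v = e.hom y) := by
    intro i
    rcases lt_trichotomy i N with hi | rfl | hi
    · exact ⟨𝟙 _, fun _ => rfl, fun _ => by lia, fun _ => Category.comp_id _, fun _ => by lia⟩
    · refine ⟨𝟙 _ - cokernel.π _ ≫ σ, fun _ => by lia, fun _ => by lia, fun _ => ?_,
        fun _ y => (ker_cokernel_π _ _).1 ?_⟩
      · rw [Preadditive.comp_sub, Category.comp_id, cokernel.condition_assoc, zero_comp, sub_zero]
      · have : (𝟙 _ - cokernel.π (P.d (i - 1) i) ≫ σ) ≫ cokernel.π (P.d (i - 1) i) = 0 := by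
          rw [Preadditive.sub_comp, Category.assoc, hσ, Category.id_comp, Category.comp_id,
            sub_self]
        exact congrArg (fun s => ModuleCat.Hom.hom s y) this
    · exact ⟨0, fun _ => by lia, fun _ => rfl, fun _ => by lia, fun _ _ => ⟨0, map_zero _⟩⟩
  choose e he₁ he₀ hde hed using hr
  let r : P ⟶ P :=
    { f := e
      comm' := fun i j hij => by
        obtain rfl : i + 1 = j := hij
        rcases lt_or_ge i N with hi | hi
        · have := hde (i + 1) (by lia)
          rw [he₁ i hi, Category.id_comp]
          obtain ⟨i', rfl⟩ : ∃ i', i = i' - 1 := ⟨i + 1, by lia⟩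
          have hi' : i' - 1 + 1 = i' := by lia
          rw [hi'] at this ⊢
          exact this.symm
        · rw [he₀ (i + 1) (by lia), comp_zero]
          refine ModuleCat.hom_ext (LinearMap.ext fun y => ?_)
          obtain ⟨v, hv⟩ := hed i hi y
          rw [ModuleCat.hom_comp, LinearMap.comp_apply, ← hv, d_d_apply]
          rfl }
  have hrr : r ≫ r = r := by
    ext i y
    change (e i).hom ((e i).hom y) = (e i).hom y
    rcases lt_or_ge i N with hi | hi
    · rw [he₁ i hi]
      rfl
    · obtain ⟨v, hv⟩ := hed i hi y
      rcases hi.lt_or_eq with hi | rfl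
      · rw [he₀ i hi]
        rfl
      · rw [← hv]
        exact congrArg (fun s => ModuleCat.Hom.hom s v) (hde N le_rfl)
  obtain ⟨P₁, P₂, ι₁, ι₂, t₂, hiso, hmono, hι₁, hι₂, ht₂⟩ := exists_biprod_iso_of_idempotent r hrr
  refine ⟨P₁, P₂, hiso, fun i hi => ?_, isContractible_of_isPureExact ?_ ?_⟩
  · have h : ι₁.f i = 0 := by
      have := HomologicalComplex.congr_hom hι₁ i
      rw [HomologicalComplex.comp_f, show r.f i = 𝟙 _ from he₁ i hi, Category.comp_id] at this
      exact this
    exact IsZero.of_mono_eq_zero _ h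
  · refine pureKProjective_iff.2 fun E hE f => ?_
    rw [← quotient_map_eq_zero_iff]
    have h := (quotient_map_eq_zero_iff _).2 (pureKProjective_iff.1 hP E hE (t₂ ≫ f))
    rw [← Category.id_comp f, ← hι₂, Category.assoc, Functor.map_comp, h, comp_zero]
  · refine isPureExact_iff_tensorExactAt.2 fun k => ?_
    rcases lt_or_ge k N with hk | hk
    · exact (hT k hk).of_retract ι₂ t₂ hι₂
    -- From degree `N` on, every element of `P₂` is a boundary, so tensor exactness holds without
    -- using the system.
    · have hx : ∀ x : P₂.X k, ∃ z, (P₂.d (k - 1) k).hom z = x := fun x => by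
        have hret : (t₂.f k).hom ((ι₂.f k).hom x) = x :=
          congrArg (fun s => ModuleCat.Hom.hom (HomologicalComplex.Hom.f s k) x) hι₂
        have hproj : (ι₂.f k).hom x = (e k).hom ((ι₂.f k).hom x) := by
          have := congrArg (fun s => ModuleCat.Hom.hom (HomologicalComplex.Hom.f s k)
            ((ι₂.f k).hom x)) ht₂
          refine Eq.trans ?_ this
          exact (congrArg (ι₂.f k).hom hret).symm
        obtain ⟨v, hv⟩ := hed k hk ((ι₂.f k).hom x)
        exact ⟨(t₂.f (k - 1)).hom v, by rw [hom_comm_apply, hv, ← hproj, hret]⟩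
      intro m n a x b _
      choose z hz using fun i => hx (x i)
      exact ⟨0, z, fun i => by simp [hz]⟩

end Splitting

end PureDerived

end

/-! ### The equivalences -/

theorem theorem4p5 {R : Type u} [Ring R] (X : CochainComplex (ModuleCat.{u} R) ℤ)
    (hX : PureDerived.InDbPur X) (n : ℤ) :
    List.TFAE [
      PureDerived.PPDLE X n,
      (((-n : ℤ) : ℝ) : EReal) ≤ PureDerived.infP X ∧
        ∀ ρ : PureDerived.PureProjRes X,
          PureDerived.IsPureProjective (cokernel (ρ.P.d (-n - 1) (-n))),
      ∀ ρ : PureDerived.PureProjRes X,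
        ∃ P₁ P₂ : CochainComplex (ModuleCat.{u} R) ℤ,
          Nonempty (ρ.P ≅ P₁ ⊞ P₂) ∧ (∀ i : ℤ, i < -n → IsZero (P₁.X i)) ∧
            PureDerived.IsContractible P₂,
      ∀ (Y : CochainComplex (ModuleCat.{u} R) ℤ) (i : ℤ),
        ((n : ℝ) : EReal) + PureDerived.supP Y < ((i : ℝ) : EReal) →
          IsZero (PureDerived.Pext i X Y),
      (((-n : ℤ) : ℝ) : EReal) ≤ PureDerived.infP X ∧
        ∀ N : ModuleCat.{u} R, IsZero (PureDerived.Pext (n + 1) X (PureDerived.stalk N))] := by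
  obtain ⟨ρ⟩ := hX.nonempty_pureProjRes
  tfae_have 1 → 4 := by
    rintro ⟨σ, hσ⟩ Y i hi
    refine (PureDerived.isZero_pext_iff σ i).2
      (PureDerived.mem_coboundaries_of_isZero σ.pureKProjective σ.isPureProjective hσ
        fun k hk => ?_)
    refine (PureDerived.isPureExactAt_iff.1 (PureDerived.isPureExactAt_of_supP_lt ?_)).1
    have hik : ((i : ℝ) : EReal) ≤ ((n : ℝ) : EReal) + ((k : ℝ) : EReal) := by
      rw [← EReal.coe_add, EReal.coe_le_coe_iff]
      exact_mod_cast (by lia : i ≤ n + k)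
    -- Monotonicity of adding the finite number `n` covers infinite values of `supP Y` too.
    by_contra hs
    exact absurd (hi.trans_le hik) (not_lt.2 (add_le_add_right (not_lt.1 hs) _))
  tfae_have 4 → 5 := by
    intro h
    have hstalk : ∀ (N : ModuleCat.{u} R) (i : ℤ), n < i →
        IsZero (PureDerived.Pext i X (PureDerived.stalk N)) := fun N i hi => by
      refine h _ _ ((add_le_add_right (PureDerived.supP_stalk_le N) _).trans_lt ?_)
      rw [Int.cast_zero, EReal.coe_zero, add_zero, EReal.coe_lt_coe_iff]
      exact_mod_cast hi
    refine ⟨(PureDerived.le_infP_iff _).2 fun k hk => ?_, fun N => hstalk N _ (by lia)⟩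
    refine ρ.isPureQuasiIso.tensorExactAt_target ?_
    -- A map from the degree `k` part to a module has degree `-k`, which exceeds `n` exactly when `k
    -- < -n`.
    obtain ⟨g, hg⟩ := PureDerived.exists_d_comp_eq_cokernel_π (P := ρ.P) (i := -k) (p := k)
      (p' := k - 1) (by lia) (by lia) rfl
      ((PureDerived.isZero_pext_iff ρ _).1 (hstalk _ (-k) (by lia)))
    exact PureDerived.tensorExactAt_of_d_comp_eq g hg
  tfae_have 5 → 2 := by
    rintro ⟨hinf, h⟩
    refine ⟨hinf, fun σ => ?_⟩
    obtain ⟨g, hg⟩ := PureDerived.exists_d_comp_eq_cokernel_π (P := σ.P) (i := n + 1)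
      (p := -n - 1) (p' := -n - 2) (p'' := -n) (by lia) (by lia) (by lia)
      ((PureDerived.isZero_pext_iff σ _).1 (h _))
    exact PureDerived.isPureProjective_cokernel_of_d_comp_eq (σ.isPureProjective _) g hg
  tfae_have 2 → 3 := by
    rintro ⟨hinf, h⟩ σ
    exact PureDerived.exists_biprod_iso_of_isPureProjective_cokernel σ.pureKProjective (-n)
      (fun k hk => σ.isPureQuasiIso.tensorExactAt_source
        ((PureDerived.le_infP_iff _).1 hinf k hk)) (h σ)
  tfae_have 3 → 1 := by
    intro h
    obtain ⟨P₁, P₂, ⟨e⟩, hP₁, hP₂⟩ := h ρ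
    let q := HomotopyCategory.quotient (ModuleCat.{u} R) (.up ℤ)
    have hq : q.map (𝟙 P₂) = 0 := (PureDerived.quotient_map_eq_zero_iff _).2 hP₂
    have hsnd : q.map (biprod.snd ≫ biprod.inr : P₁ ⊞ P₂ ⟶ P₁ ⊞ P₂) = 0 := by
      rw [← Category.id_comp biprod.inr, Functor.map_comp, Functor.map_comp, hq, zero_comp,
        comp_zero]
    -- The contractible summand is zero in the homotopy category, so the projection onto `P₁`
    -- becomes the identity there.
    have hfst : q.map (biprod.fst ≫ biprod.inl : P₁ ⊞ P₂ ⟶ P₁ ⊞ P₂) = 𝟙 _ := by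
      rw [← q.map_id, ← biprod.total, Functor.map_add, hsnd, add_zero]
    let ε : q.obj P₁ ≅ q.obj ρ.P :=
      { hom := q.map (biprod.inl ≫ e.inv)
        inv := q.map (e.hom ≫ biprod.fst)
        hom_inv_id := by
          rw [← Functor.map_comp, Category.assoc, e.inv_hom_id_assoc, biprod.inl_fst,
            q.map_id]
        inv_hom_id := by
          rw [← Functor.map_comp, Category.assoc, ← Category.assoc biprod.fst, Functor.map_comp,
            Functor.map_comp, hfst, Category.id_comp, ← Functor.map_comp, e.hom_inv_id,
            q.map_id] }
    have hK : PureDerived.pureKProjective R (q.obj P₁) :=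
      (PureDerived.pureKProjective R).prop_of_iso ε.symm ρ.pureKProjective
    refine ⟨{
      P := P₁
      f := (biprod.inl ≫ e.inv) ≫ ρ.f
      isPureQuasiIso := (PureDerived.isPureQuasiIso_iff_trW _).2 ?_
      isPureProjective := fun i => (ρ.isPureProjective i).of_retract
        ((biprod.inl ≫ e.inv).f i) ((e.hom ≫ biprod.fst).f i) ?_
      preserves := fun E hE => PureDerived.isPureExact_homComplex_of_pureKProjective hK hE }, hP₁⟩
    · rw [Functor.map_comp]
      have : IsIso (q.map (biprod.inl ≫ e.inv)) := ε.isIso_hom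
      exact (MorphismProperty.cancel_left_of_respectsIso _ _ _).2
        ((PureDerived.isPureQuasiIso_iff_trW _).1 ρ.isPureQuasiIso)
    · rw [← HomologicalComplex.comp_f, Category.assoc, e.inv_hom_id_assoc, biprod.inl_fst,
        HomologicalComplex.id_f]
  tfae_finish
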